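/- **Setting.** Let $R$ be a ring with $1$ and $F$ a set of operation symbols, each $f\in F$ of arity $\mathrm{ar} f\ge 1$. Let $\mathcal V$ be a variety of $R$-modules expanded by multilinear operations named by $F$: a class of (unital) $R$-modules $M$ with operations $f^M:M^{\mathrm{ar} f}\to M$ ($f\in F$) that are $R$-linear in each coordinate, defined by a set of identities. Let $M\in\mathcal V$ be an extension $0\to I\xrightarrow{\iota} M\xrightarrow{\pi} Q\to 0$ (a short exact sequence of modules, with $\iota,\pi$ preserving all $f\in F$), and identify $I$ with $\iota(I)=\ker\pi$. Fix a map $l:Q\to M$ with $\pi l=\mathrm{id}_Q$, $l(0)=0$. A *unary action* of $X$ on an $R$-module $B$ consists of $a(f,i)(x_1,\dots,x_{i-1},b,x_{i+1},\dots,x_n)\in B$ for $f\in F$, $n=\mathrm{ar}f$, $1\le i\le n$, $x_j\in X$, $b\in B$, which are $R$-linear in $b$ and zero if some $x_j=0$; write $a(f,i)(\vec x,b)$, which ignores $x_i$. For maps $T_+:X^2\to B$, $T_r:X\to B$ $(r\in R)$, $T_f:X^{\mathrm{ar}f}\to B$ $(f\in F)$ ("factor sets"), $B\rtimes_T X$ is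 the set $B\times X$ with $\langle a,x\rangle+\langle b,y\rangle=\langle a+b+T_+(x,y),x+y\rangle$, $r\langle a,x\rangle=\langle ra+T_r(x),rx\rangle$, zero element $\langle 0,0\rangle$, negation $(-1)\cdot(\,)$, and $f(\langle b_1,x_1\rangle,\dots)=\langle\sum_i a(f,i)(\vec x,b_i)+T_f(\vec x),f^X(\vec x)\rangle$. For $T=0$ write $B\rtimes X$; the action is *$\mathcal V$-compatible* if $B\rtimes X\in\mathcal V$. Let $(M,A,*)$ be *affine datum* in $\mathcal V$: $A\in\mathcal V$ is an abelian algebra (for the term-condition commutator) and $*=\{a(f,i)\}$ is a $\mathcal V$-compatible unary action of $M$ on $A$, where for $\mathrm{ar} f=1$ we put $a(f,1)=f^A$. **Null submodule.** $A^I$ is the set of $a\in A$ with $t(a,\vec m)=0$ for every iterated composition $t$ of action terms $a(f,i)$ (in their $A$-variable) and all $\vec m$ having some entry in $I$. By restriction, $M$ and $I$ act on $A^I$ (again written $*$); $\hat *$ is the action of $Q$ on $A^I$ given by $\hat a(f,i)(\vec x,a)=a(f,i)(l(\vec x),a)$. **Cohomology.** For a unary action of $X$ on $B$, the *coboundary*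 $\partial h$ of $h:X\to B$ is $(\partial h)_+(x,y)=h(x)+h(y)-h(x+y)$, $(\partial h)_r(x)=r\,h(x)-h(rx)$, $(\partial h)_f(\vec x)=\sum_i a(f,i)(\vec x,h(x_i))-h(f^X(\vec x))$. Derivations are the $h$ with $\partial h=0$. A derivation $d$ is *principal* if the map $\gamma\langle b,x\rangle=\langle b-d(x),x\rangle$ of $B\rtimes X$ has a fixed point and there are a term $t(z,\vec y)$ and tuples $\vec c,\vec e$ in $B\times\{0\}$ with $\gamma(z)=t(z,\vec c)$ and $z=t(z,\vec e)$ for all $z$. Put $H^1(X,B,*)=\mathrm{Der}(X,B,*)/\mathrm{PDer}(X,B,*)$ (derivations modulo principal ones). A *strictly $\mathcal V$-compatible 2-cocycle* is a family of factor sets $T$ with $T_+(x,0)=T_+(0,x)=0$, $T_r(0)=0$, $T_f(\vec x)=0$ if some $x_i=0$, and $t^{\partial,T}=s^{\partial,T}$ for all identities $t=s$ of $\mathcal V$, where $t^{\partial,T}(\vec x)$ is the sum of the summands involving a factor set in the first coordinate of the value of $t$ in $B\rtimes_T X$. $H^2_{\mathcal V}(X,B,*)$ is the group of these modulo coboundaries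 $\partial h$ with $h(0)=0$. **The $\square$-condition and $T$.** For $f\in F$, $n=\mathrm{ar}f$, $\emptyset\ne s\subsetneq\{1,\dots,n\}$, $\vec x\in Q^n$, $\vec b\in I^n$, let $l(\vec x)_s[\vec b]\in M^n$ be $l(\vec x)$ with its $s$-entries replaced by those of $\vec b$. $H^1(I,A^I,*)^\square$ is the subgroup of classes of derivations $d:I\to A^I$ for which some $h:Q\to A^I$ satisfies, for all $f,s,\vec x,\vec b$, $$d\big(f^M(l(\vec x)_s[\vec b])\big)=\sum_{i\notin s}a(f,i)\big(l(\vec x)_s[\vec b],h(x_i)\big)+\sum_{i\in s}a(f,i)\big(l(\vec x)_s[\vec b],d(b_i)\big).$$ Let $T$ be the factor sets of the extension: $T_+(x,y)=l(x)+l(y)-l(x+y)$, $T_r(x)=r\,l(x)-l(rx)$, $T_f(\vec x)=f^M(l(\vec x))-l(f^Q(\vec x))$, with values in $I$. **Theorem.** $A^I$ is a subalgebra of $A$, $\hat a(f,i)(\pi(\vec m),a)=a(f,i)(\vec m,a)$ for $\vec m\in M^{\mathrm{ar} f}$, $a\in A^I$, and $\hat *$ is $\mathcal V$-compatible. There are well-defined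 group homomorphisms $\sigma[d]=[d\circ\pi]$ (inflation), $r[d]=[d|_I]$ (restriction), $\delta_T[d]=[d\circ T]$ (transgression) and $\sigma[S]=[S\circ\pi]$ (inflation) for which the sequence $$0\to H^1(Q,A^I,\hat *)\xrightarrow{\sigma}H^1(M,A^I,*)\xrightarrow{r}H^1(I,A^I,*)^{\square}\xrightarrow{\delta_T}H^2_{\mathcal V}(Q,A^I,\hat *)\xrightarrow{\sigma}H^2_{\mathcal V}(M,A^I,*)$$ is exact. -/

import Mathlib

namespace MultExp

universe uR uF u v w

/-! ## Terms, raw algebras and varieties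

The signature consists of `0`, `+`, scalar multiplication by each `r : R` and one operation symbol
of arity `ar f` for each `f : F`.  Negation is the term operation `(-1) • x`. -/

/-- Terms in the signature with variables from `X`. -/
inductive Term (R : Type uR) {F : Type uF} (ar : F → ℕ) (X : Type u) : Type (max uR uF u) where
  | var (x : X) : Term R ar X
  | zero : Term R ar X
  | add (s t : Term R ar X) : Term R ar X
  | smul (r : R) (t : Term R ar X) : Term R ar X
  | op (f : F) (ts : Fin (ar f) → Term R ar X) : Term R ar X

/-- Simultaneous substitution of terms for variables. -/
def Term.subst {R : Type uR} {F : Type uF} {ar : F → ℕ} {X : Type u} {Y : Type v}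
    (σ : X → Term R ar Y) : Term R ar X → Term R ar Y
  | .var x => σ x
  | .zero => .zero
  | .add s t => .add (s.subst σ) (t.subst σ)
  | .smul r t => .smul r (t.subst σ)
  | .op f ts => .op f (fun i => (ts i).subst σ)

/-- An interpretation of the signature on a set, with no laws imposed. -/
structure RawAlg (R : Type uR) {F : Type uF} (ar : F → ℕ) (X : Type u) where
  zero : X
  add : X → X → X
  smul : R → X → X
  op : (f : F) → (Fin (ar f) → X) → X

/-- The value of a term in an algebra under an assignment of the variables. -/
def RawAlg.eval {R : Type uR} {F : Type uF} {ar : F → ℕ} {X : Type u} {Y : Type v}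
    (𝔸 : RawAlg R ar X) (e : Y → X) : Term R ar Y → X
  | .var y => e y
  | .zero => 𝔸.zero
  | .add s t => 𝔸.add (𝔸.eval e s) (𝔸.eval e t)
  | .smul r t => 𝔸.smul r (𝔸.eval e t)
  | .op f ts => 𝔸.op f (fun i => 𝔸.eval e (ts i))

theorem RawAlg.eval_subst {R : Type uR} {F : Type uF} {ar : F → ℕ} {X : Type u} {Y : Type v}
    {Z : Type w} (𝔸 : RawAlg R ar X) (e : Z → X) (σ : Y → Term R ar Z) (t : Term R ar Y) :
    𝔸.eval e (t.subst σ) = 𝔸.eval (fun y => 𝔸.eval e (σ y)) t := by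
  induction t with
  | var y => rfl
  | zero => rfl
  | add s t hs ht => simp only [Term.subst, RawAlg.eval, hs, ht]
  | smul r t ht => simp only [Term.subst, RawAlg.eval, ht]
  | op f ts h => simp only [Term.subst, RawAlg.eval, h]

/-- The identities defining the largest variety of `R`-modules expanded by multilinear operations
named by `F`: the axioms of (unital) `R`-modules, and linearity of each `f` in each coordinate. -/
inductive BaseIdentity {R : Type uR} [Ring R] {F : Type uF} (ar : F → ℕ) :
    Term R ar ℕ → Term R ar ℕ → Prop where
  | add_assoc : BaseIdentity ar (.add (.add (.var 0) (.var 1)) (.var 2))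
      (.add (.var 0) (.add (.var 1) (.var 2)))
  | add_comm : BaseIdentity ar (.add (.var 0) (.var 1)) (.add (.var 1) (.var 0))
  | add_zero : BaseIdentity ar (.add (.var 0) .zero) (.var 0)
  | add_neg : BaseIdentity ar (.add (.var 0) (.smul (-1) (.var 0))) .zero
  | one_smul : BaseIdentity ar (.smul 1 (.var 0)) (.var 0)
  | mul_smul (r s : R) : BaseIdentity ar (.smul (r * s) (.var 0)) (.smul r (.smul s (.var 0)))
  | add_smul (r s : R) : BaseIdentity ar (.smul (r + s) (.var 0))
      (.add (.smul r (.var 0)) (.smul s (.var 0)))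
  | smul_add (r : R) : BaseIdentity ar (.smul r (.add (.var 0) (.var 1)))
      (.add (.smul r (.var 0)) (.smul r (.var 1)))
  | linear (f : F) (i : Fin (ar f)) (r : R) : BaseIdentity ar
      (.op f (Function.update (fun j : Fin (ar f) => Term.var j.val) i
        (.add (.smul r (.var (ar f))) (.var (ar f + 1)))))
      (.add (.smul r (.op f (Function.update (fun j : Fin (ar f) => Term.var j.val) i
          (.var (ar f)))))
        (.op f (Function.update (fun j : Fin (ar f) => Term.var j.val) i (.var (ar f + 1)))))

/-- A variety of `R`-modules expanded by multilinear operations named by `F`, given by a set of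
identities that contains the module axioms and the multilinearity of the operations. -/
structure Variety (R : Type uR) [Ring R] {F : Type uF} (ar : F → ℕ) where
  ids : Set (Term R ar ℕ × Term R ar ℕ)
  base : ∀ s t : Term R ar ℕ, BaseIdentity ar s t → (s, t) ∈ ids

/-- The algebra satisfies all the identities of the variety. -/
def Variety.Models {R : Type uR} [Ring R] {F : Type uF} {ar : F → ℕ} (V : Variety R ar)
    {X : Type u} (𝔸 : RawAlg R ar X) : Prop :=
  ∀ p ∈ V.ids, ∀ e : ℕ → X, 𝔸.eval e p.1 = 𝔸.eval e p.2

/-- Multilinear operations named by `F` on an `R`-module. -/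
class MultiOps (R : Type uR) [Ring R] {F : Type uF} (ar : F → ℕ) (M : Type u) [AddCommGroup M]
    [Module R M] where
  op : (f : F) → MultilinearMap R (fun _ : Fin (ar f) => M) M

/-- The value `f^M(m)` of the multilinear operation named by `f`. -/
abbrev mop (R : Type uR) [Ring R] {F : Type uF} (ar : F → ℕ) {M : Type u} [AddCommGroup M]
    [Module R M] [MultiOps R ar M] (f : F) (m : Fin (ar f) → M) : M :=
  MultiOps.op (R := R) (ar := ar) (M := M) f m

/-- The module `M` with its multilinear operations as an interpretation of the signature. -/
def toRaw (R : Type uR) [Ring R] {F : Type uF} (ar : F → ℕ) (M : Type u) [AddCommGroup M]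
    [Module R M] [MultiOps R ar M] : RawAlg R ar M where
  zero := 0
  add x y := x + y
  smul r x := r • x
  op f m := mop R ar f m

/-- `M ∈ 𝒱`. -/
def Variety.Mem {R : Type uR} [Ring R] {F : Type uF} {ar : F → ℕ} (V : Variety R ar)
    (M : Type u) [AddCommGroup M] [Module R M] [MultiOps R ar M] : Prop :=
  V.Models (toRaw R ar M)

/-- `A` is an abelian algebra, by the term condition: the total congruence centralizes itself
modulo equality. -/
def IsAbelianAlg (R : Type uR) [Ring R] {F : Type uF} (ar : F → ℕ) (A : Type u) [AddCommGroup A]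
    [Module R A] [MultiOps R ar A] : Prop :=
  ∀ (k m : ℕ) (t : Term R ar (Fin k ⊕ Fin m)) (a b : Fin k → A) (c d : Fin m → A),
    (toRaw R ar A).eval (Sum.elim a c) t = (toRaw R ar A).eval (Sum.elim a d) t →
    (toRaw R ar A).eval (Sum.elim b c) t = (toRaw R ar A).eval (Sum.elim b d) t

/-! ## Linear actions, 2-cochains and crossed products -/

/-- The action terms `a(f,i)`, `i ∈ [ar f]`, of an action of `Q` on the module `A` all of whose
terms are unary in `A`.  The tuple of elements of `Q` is indexed by all coordinates, but
`a(f,i)` does not depend on its `i`-th entry, that coordinate being occupied by the element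
of `A`: `act f i q a = a(f,i)(q₁,…,qᵢ₋₁,a,qᵢ₊₁,…,qₙ)`. -/
structure LinearAction (R : Type uR) [Ring R] {F : Type uF} (ar : F → ℕ) (Q : Type u) (A : Type v)
    [AddCommGroup Q] [AddCommGroup A] [Module R A] where
  act : (f : F) → Fin (ar f) → (Fin (ar f) → Q) → A →ₗ[R] A
  act_indep : ∀ (f : F) (i : Fin (ar f)) (x y : Fin (ar f) → Q),
    (∀ j, j ≠ i → x j = y j) → act f i x = act f i y
  act_zero : ∀ (f : F) (i : Fin (ar f)) (x : Fin (ar f) → Q) (j : Fin (ar f)),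
    j ≠ i → x j = 0 → act f i x = 0

/-- Factor sets `(T₊, (Tᵣ)ᵣ, (T_f)_f)`. -/
abbrev Cochain (R : Type uR) {F : Type uF} (ar : F → ℕ) (Q : Type u) (A : Type v) :
    Type (max uR uF u v) :=
  (Q → Q → A) × (R → Q → A) × ((f : F) → (Fin (ar f) → Q) → A)

section

variable {R : Type uR} [Ring R] {F : Type uF} {ar : F → ℕ} {Q : Type u} {A : Type v}
  [AddCommGroup Q] [Module R Q] [MultiOps R ar Q] [AddCommGroup A] [Module R A]

/-- The algebra `A ⋊_T Q` on `A × Q` for a linear action and factor sets `T`. -/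
def crossed (α : LinearAction R ar Q A) (T : Cochain R ar Q A) : RawAlg R ar (A × Q) where
  zero := (0, 0)
  add z w := (z.1 + w.1 + T.1 z.2 w.2, z.2 + w.2)
  smul r z := (r • z.1 + T.2.1 r z.2, r • z.2)
  op f z := ((∑ i, α.act f i (fun j => (z j).2) (z i).1) + T.2.2 f (fun j => (z j).2),
    mop R ar f (fun j => (z j).2))

/-- The action is `𝒱`-compatible: the semidirect product `A ⋊ Q` (zero factor sets) satisfies the
identities of `𝒱`. -/
def IsCompatible (V : Variety R ar) (α : LinearAction R ar Q A) : Prop :=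
  V.Models (crossed α 0)

/-- The 2-coboundary determined by `h : Q → A`. -/
def cobound (α : LinearAction R ar Q A) : (Q → A) →+ Cochain R ar Q A where
  toFun h :=
    (fun x y => h x + h y - h (x + y),
     fun r x => r • h x - h (r • x),
     fun f x => (∑ i, α.act f i x (h (x i))) - h (mop R ar f x))
  map_zero' := by
    refine Prod.ext ?_ (Prod.ext ?_ ?_)
    · funext x y; simp
    · funext r x; simp
    · funext f x; simp
  map_add' h k := by
    refine Prod.ext ?_ (Prod.ext ?_ ?_)
    · funext x y; simp only [Pi.add_apply, Prod.fst_add]; abel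
    · funext r x; simp only [Pi.add_apply, Prod.fst_add, Prod.snd_add, smul_add]; abel
    · funext f x
      simp only [Pi.add_apply, Prod.snd_add, map_add, Finset.sum_add_distrib]; abel

/-- Derivations (1-cocycles): the maps `Q → A` that determine the null 2-coboundary. -/
def Der (α : LinearAction R ar Q A) : AddSubgroup (Q → A) := (cobound α).ker

theorem Der.map_add {α : LinearAction R ar Q A} (d : Der α) (x y : Q) :
    d.1 (x + y) = d.1 x + d.1 y := by
  have h : cobound α d.1 = 0 := d.2
  have h1 : d.1 x + d.1 y - d.1 (x + y) = 0 := congrFun (congrFun (congrArg Prod.fst h) x) y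
  exact (sub_eq_zero.mp h1).symm

theorem Der.map_zero {α : LinearAction R ar Q A} (d : Der α) : d.1 0 = 0 := by
  have h := Der.map_add d 0 0
  simpa using h

/-- The stabilizing automorphism `(a,x) ↦ (a - d x, x)` of the semidirect product that
corresponds to a derivation `d`. -/
def stabMap (d : Q → A) (z : A × Q) : A × Q := (z.1 - d z.2, z.2)

/-- `p` is an `S`-twin of the identity: there are a term `t(x,y₁,…,y_k)` and tuples `c`, `e` in `S`
with `p(x) = t(x,c)` and `x = t(x,e)` for all `x`. -/
def IsTwinOfId {X : Type w} (𝔸 : RawAlg R ar X) (S : Set X) (p : X → X) : Prop :=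
  ∃ (k : ℕ) (t : Term R ar (Option (Fin k))) (c e : Fin k → X),
    (∀ j, c j ∈ S) ∧ (∀ j, e j ∈ S) ∧
    (∀ x, p x = 𝔸.eval (fun o => o.elim x c) t) ∧
    (∀ x, x = 𝔸.eval (fun o => o.elim x e) t)

/-- `d` is principal: in the semidirect product `A ⋊ Q`, the stabilizing automorphism of `d` is a
twin of the identity with respect to the ideal `A × 0`, and it has a fixed point.  (For a derivation
`d` the map `stabMap d` is an automorphism, stabilizing the extension `A ⋊ Q → Q`.) -/
def IsPrincipal (α : LinearAction R ar Q A) (d : Q → A) : Prop :=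
  IsTwinOfId (crossed α 0) {z : A × Q | z.2 = 0} (stabMap d) ∧ ∃ z : A × Q, stabMap d z = z

theorem isPrincipal_zero (α : LinearAction R ar Q A) : IsPrincipal α (0 : Q → A) := by
  refine ⟨⟨0, .var none, Fin.elim0, Fin.elim0, fun j => j.elim0, fun j => j.elim0, ?_, ?_⟩, 0, ?_⟩
  · intro x; simp [stabMap, RawAlg.eval]
  · intro x; simp [RawAlg.eval]
  · simp [stabMap]

theorem isPrincipal_add (α : LinearAction R ar Q A) {d d' : Q → A} (h0 : d 0 = 0) (h0' : d' 0 = 0)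
    (h : IsPrincipal α d) (h' : IsPrincipal α d') : IsPrincipal α (d + d') := by
  obtain ⟨⟨k, t, c, e, hc, he, htc, hte⟩, -⟩ := h
  obtain ⟨⟨m, s, c', e', hc', he', hsc, hse⟩, -⟩ := h'
  obtain ⟨u, key⟩ : ∃ u : Term R ar (Option (Fin (k + m))),
      ∀ (c : Fin k → A × Q) (c' : Fin m → A × Q) (x : A × Q),
      (crossed α 0).eval (fun o => o.elim x (Fin.append c c')) u =
      (crossed α 0).eval (fun o => o.elim ((crossed α 0).eval (fun o => o.elim x c') s) c) t := by
    refine ⟨t.subst (fun o => o.elim (s.subst fun o' => .var (o'.map (Fin.natAdd k)))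
      (fun j => .var (some (Fin.castAdd m j)))), fun c c' x => ?_⟩
    rw [RawAlg.eval_subst]
    congr 1
    funext o
    cases o with
    | none =>
      simp only [Option.elim_none, RawAlg.eval_subst]
      congr 1
      funext o'
      cases o' <;> simp [RawAlg.eval]
    | some j => simp [RawAlg.eval]
  refine ⟨⟨k + m, u, Fin.append c c', Fin.append e e', ?_, ?_, fun x => ?_, fun x => ?_⟩, 0, ?_⟩
  · intro j; refine Fin.addCases (fun j => ?_) (fun j => ?_) j
    · rw [Fin.append_left]; exact hc j
    · rw [Fin.append_right]; exact hc' j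
  · intro j; refine Fin.addCases (fun j => ?_) (fun j => ?_) j
    · rw [Fin.append_left]; exact he j
    · rw [Fin.append_right]; exact he' j
  · refine Eq.trans ?_ (key c c' x).symm
    rw [← hsc, ← htc]
    refine Prod.ext ?_ rfl
    simp only [stabMap, Pi.add_apply]; abel
  · refine Eq.trans ?_ (key e e' x).symm
    rw [← hse, ← hte]
  · simp [stabMap, h0, h0']

theorem isPrincipal_neg (α : LinearAction R ar Q A) {d : Q → A} (h0 : d 0 = 0)
    (h : IsPrincipal α d) : IsPrincipal α (-d) := by
  obtain ⟨⟨k, t, c, e, hc, he, htc, hte⟩, -⟩ := h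
  obtain ⟨u, key⟩ : ∃ u : Term R ar (Option (Fin (k + k))),
      ∀ (c c' : Fin k → A × Q) (x : A × Q),
      (crossed α 0).eval (fun o => o.elim x (Fin.append c c')) u =
      (crossed α 0).eval (fun o => o.elim x c') t - (crossed α 0).eval (fun o => o.elim x c) t
        + x := by
    refine ⟨.add (.add (t.subst (fun o => .var (o.map (Fin.natAdd k))))
      (.smul (-1) (t.subst (fun o => .var (o.map (Fin.castAdd k)))))) (.var none),
      fun c c' x => ?_⟩
    have h1 : (crossed α 0).eval (fun o => o.elim x (Fin.append c c'))
        (t.subst (fun o => .var (o.map (Fin.natAdd k)))) =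
        (crossed α 0).eval (fun o => o.elim x c') t := by
      rw [RawAlg.eval_subst]; congr 1; funext o
      cases o with
      | none => rfl
      | some j => exact Fin.append_right c c' j
    have h2 : (crossed α 0).eval (fun o => o.elim x (Fin.append c c'))
        (t.subst (fun o => .var (o.map (Fin.castAdd k)))) =
        (crossed α 0).eval (fun o => o.elim x c) t := by
      rw [RawAlg.eval_subst]; congr 1; funext o; cases o <;> simp [RawAlg.eval]
    simp only [RawAlg.eval, h1, h2]
    refine Prod.ext ?_ ?_ <;> simp [crossed, sub_eq_add_neg]
  refine ⟨⟨k + k, u, Fin.append c e, Fin.append e e, ?_, ?_, fun x => ?_, fun x => ?_⟩, 0, ?_⟩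
  · intro j; refine Fin.addCases (fun j => ?_) (fun j => ?_) j
    · rw [Fin.append_left]; exact hc j
    · rw [Fin.append_right]; exact he j
  · intro j; refine Fin.addCases (fun j => ?_) (fun j => ?_) j
    · rw [Fin.append_left]; exact he j
    · rw [Fin.append_right]; exact he j
  · refine Eq.trans ?_ (key c e x).symm
    rw [← hte, ← htc]
    refine Prod.ext ?_ ?_ <;> simp [stabMap, add_comm]
  · refine Eq.trans ?_ (key e e x).symm
    simp
  · simp [stabMap, h0]

/-- Principal derivations, as a subgroup of the derivations. -/
def PDer (α : LinearAction R ar Q A) : AddSubgroup (Der α) where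
  carrier := {d | IsPrincipal α d.1}
  zero_mem' := isPrincipal_zero α
  add_mem' {d d'} h h' := isPrincipal_add α (Der.map_zero d) (Der.map_zero d') h h'
  neg_mem' {d} h := isPrincipal_neg α (Der.map_zero d) h

/-- First cohomology `H¹(Q,A,∗) = Der / PDer`. -/
abbrev H1 (α : LinearAction R ar Q A) : Type _ := Der α ⧸ PDer α

/-- The class in `H¹(Q,A,∗)` of a derivation. -/
abbrev H1.mk {α : LinearAction R ar Q A} (d : Der α) : H1 α := QuotientAddGroup.mk d

/-- The part `t^{∂,T}` of the value of the term `t` in `A ⋊_T Q` that collects all summands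
involving a factor set.  It depends only on the `Q`-coordinates `x` of the variables:
`F_t(a,x) = ⟨t^∗(a,x) + t^{∂,T}(x), t^Q(x)⟩`. -/
def strictPart (α : LinearAction R ar Q A) (T : Cochain R ar Q A) {X : Type w} (x : X → Q) :
    Term R ar X → A
  | .var _ => 0
  | .zero => 0
  | .add s t => strictPart α T x s + strictPart α T x t +
      T.1 ((toRaw R ar Q).eval x s) ((toRaw R ar Q).eval x t)
  | .smul r t => r • strictPart α T x t + T.2.1 r ((toRaw R ar Q).eval x t)
  | .op f ts =>
      (∑ i, α.act f i (fun j => (toRaw R ar Q).eval x (ts j)) (strictPart α T x (ts i))) +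
        T.2.2 f (fun j => (toRaw R ar Q).eval x (ts j))

theorem strictPart_zero (α : LinearAction R ar Q A) {X : Type w} (x : X → Q) (t : Term R ar X) :
    strictPart α 0 x t = 0 := by
  induction t with
  | var y => rfl
  | zero => rfl
  | add s t hs ht => simp [strictPart, hs, ht]
  | smul r t ht => simp [strictPart, ht]
  | op f ts h => simp [strictPart, h]

theorem strictPart_add (α : LinearAction R ar Q A) (S T : Cochain R ar Q A) {X : Type w}
    (x : X → Q) (t : Term R ar X) :
    strictPart α (S + T) x t = strictPart α S x t + strictPart α T x t := by
  induction t with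
  | var y => simp [strictPart]
  | zero => simp [strictPart]
  | add s t hs ht => simp only [strictPart, hs, ht, Prod.fst_add, Pi.add_apply]; abel
  | smul r t ht =>
    simp only [strictPart, ht, Prod.fst_add, Prod.snd_add, Pi.add_apply, smul_add]; abel
  | op f ts h =>
    simp only [strictPart, h, Prod.snd_add, Pi.add_apply, map_add, Finset.sum_add_distrib]; abel

theorem strictPart_neg (α : LinearAction R ar Q A) (T : Cochain R ar Q A) {X : Type w}
    (x : X → Q) (t : Term R ar X) : strictPart α (-T) x t = -strictPart α T x t := by
  have h := strictPart_add α (-T) T x t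
  rw [neg_add_cancel, strictPart_zero] at h
  exact eq_neg_of_add_eq_zero_left h.symm

/-- The strictly `𝒱`-compatible 2-cocycles of the datum `(Q,A,∗)`: normalized factor sets that
satisfy `t^{∂,T} = s^{∂,T}` for all identities `t = s` of `𝒱`. -/
def Z2 (V : Variety R ar) (α : LinearAction R ar Q A) : AddSubgroup (Cochain R ar Q A) where
  carrier := {T | (∀ x, T.1 x 0 = 0 ∧ T.1 0 x = 0) ∧ (∀ r, T.2.1 r 0 = 0) ∧
    (∀ f (x : Fin (ar f) → Q), (∃ i, x i = 0) → T.2.2 f x = 0) ∧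
    ∀ p ∈ V.ids, ∀ x : ℕ → Q, strictPart α T x p.1 = strictPart α T x p.2}
  zero_mem' := by
    refine ⟨fun x => ⟨rfl, rfl⟩, fun r => rfl, fun f x _ => rfl, fun p _ x => ?_⟩
    rw [strictPart_zero, strictPart_zero]
  add_mem' := by
    rintro S T ⟨h1, h2, h3, h4⟩ ⟨k1, k2, k3, k4⟩
    refine ⟨fun x => ⟨?_, ?_⟩, fun r => ?_, fun f x hx => ?_, fun p hp x => ?_⟩
    · simp [(h1 x).1, (k1 x).1]
    · simp [(h1 x).2, (k1 x).2]
    · simp [h2 r, k2 r]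
    · simp [h3 f x hx, k3 f x hx]
    · rw [strictPart_add, strictPart_add, h4 p hp x, k4 p hp x]
  neg_mem' := by
    rintro T ⟨h1, h2, h3, h4⟩
    refine ⟨fun x => ⟨?_, ?_⟩, fun r => ?_, fun f x hx => ?_, fun p hp x => ?_⟩
    · simp [(h1 x).1]
    · simp [(h1 x).2]
    · simp [h2 r]
    · simp [h3 f x hx]
    · rw [strictPart_neg, strictPart_neg, h4 p hp x]

/-- The 2-coboundaries of the datum: those determined by some `h : Q → A` with `h 0 = 0`. -/
def B2 (α : LinearAction R ar Q A) : AddSubgroup (Cochain R ar Q A) :=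
  AddSubgroup.map (cobound α) (Pi.evalAddMonoidHom (fun _ : Q => A) 0).ker

/-- Second cohomology `H²_𝒱(Q,A,∗)`: strictly `𝒱`-compatible 2-cocycles, two of them being
equivalent when they differ by a 2-coboundary. -/
abbrev H2 (V : Variety R ar) (α : LinearAction R ar Q A) : Type _ :=
  Z2 V α ⧸ (B2 α).addSubgroupOf (Z2 V α)

/-- The class in `H²_𝒱(Q,A,∗)` of a 2-cocycle. -/
abbrev H2.mk {V : Variety R ar} {α : LinearAction R ar Q A} (T : Z2 V α) : H2 V α :=
  QuotientAddGroup.mk T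

end

section

variable {R : Type uR} [Ring R] {F : Type uF} {ar : F → ℕ} {M : Type u} {A : Type v}
  [AddCommGroup M] [AddCommGroup A] [Module R A]

/-- Precomposition of an action with a map that preserves `0`. -/
def LinearAction.comap (α : LinearAction R ar M A) {X : Type w} [AddCommGroup X] (φ : X → M)
    (hφ : φ 0 = 0) : LinearAction R ar X A where
  act f i x := α.act f i (fun j => φ (x j))
  act_indep f i x y h := α.act_indep f i _ _ fun j hj => by rw [h j hj]
  act_zero f i x j hj hx := α.act_zero f i _ j hj (by simp only [hx, hφ])

/-- An action term `a(f,i)` together with values for the arguments from `M`. -/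
structure Step {F : Type uF} (ar : F → ℕ) (M : Type u) where
  f : F
  i : Fin (ar f)
  args : Fin (ar f) → M

/-- The iterated action terms `t(a,m)`, evaluated at `m` and viewed as maps of `a`.  The entry
`args i` of a step is a dummy: the corresponding coordinate carries the inner term. -/
def LinearAction.iter (α : LinearAction R ar M A) : List (Step ar M) → A →ₗ[R] A
  | [] => LinearMap.id
  | s :: w => (α.act s.f s.i s.args).comp (α.iter w)

theorem LinearAction.iter_append (α : LinearAction R ar M A) (w w' : List (Step ar M)) (a : A) :
    α.iter (w ++ w') a = α.iter w (α.iter w' a) := by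
  induction w with
  | nil => rfl
  | cons s w ih => simp [LinearAction.iter, ih]

/-- The null submodule `A^K`: the elements `a` with `t(a,m) = 0` for every iterated action term `t`
and every `m` with some entry in `K`. -/
def LinearAction.null (α : LinearAction R ar M A) (K : Set M) : Submodule R A where
  carrier := {a | ∀ w : List (Step ar M), (∃ s ∈ w, ∃ j, j ≠ s.i ∧ s.args j ∈ K) → α.iter w a = 0}
  zero_mem' w _ := map_zero _
  add_mem' {a b} ha hb w hw := by rw [map_add, ha w hw, hb w hw, add_zero]
  smul_mem' r a ha w hw := by rw [map_smul, ha w hw, smul_zero]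

theorem LinearAction.act_mem_null (α : LinearAction R ar M A) (K : Set M) (f : F)
    (i : Fin (ar f)) (x : Fin (ar f) → M) {a : A} (ha : a ∈ α.null K) :
    α.act f i x a ∈ α.null K := by
  rintro w ⟨s, hs, hj⟩
  have h := ha (w ++ [⟨f, i, x⟩]) ⟨s, List.mem_append_left _ hs, hj⟩
  rw [LinearAction.iter_append] at h
  exact h

/-- The action restricted to the null submodule `A^K`. -/
def LinearAction.onNull (α : LinearAction R ar M A) (K : Set M) :
    LinearAction R ar M (α.null K) where
  act f i x := (α.act f i x).restrict fun _ ha => α.act_mem_null K f i x ha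
  act_indep f i x y h := by
    refine LinearMap.ext fun a => Subtype.ext ?_
    exact congrArg (fun g : A →ₗ[R] A => g a.1) (α.act_indep f i x y h)
  act_zero f i x j hj hx := by
    refine LinearMap.ext fun a => Subtype.ext ?_
    exact congrArg (fun g : A →ₗ[R] A => g a.1) (α.act_zero f i x j hj hx)

end

/-! ## Affine datum and extensions -/

/-- `(M,A,∗)` is affine datum in `𝒱` (where `M ∈ 𝒱`): `A ∈ 𝒱` is an abelian algebra and the action
of `M` on `A` is unary in `A` and `𝒱`-compatible.  For an operation `f` of arity one there is no
proper nonempty set of coordinates, and `a(f,1)` stands for `f^A`. -/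
structure AffineDatum {R : Type uR} [Ring R] {F : Type uF} {ar : F → ℕ} (V : Variety R ar)
    (M : Type u) (A : Type v) [AddCommGroup M] [Module R M] [MultiOps R ar M]
    [AddCommGroup A] [Module R A] [MultiOps R ar A] where
  action : LinearAction R ar M A
  mem : V.Mem A
  abelian : IsAbelianAlg R ar A
  act_unary : ∀ (f : F) (i : Fin (ar f)), ar f = 1 → ∀ (x : Fin (ar f) → M) (a : A),
    action.act f i x a = mop R ar f (fun _ => a)
  compatible : IsCompatible V action

/-- An extension `0 → I → M → Q → 0`. -/
structure Extension (R : Type uR) [Ring R] {F : Type uF} (ar : F → ℕ) (I : Type u) (M : Type v)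
    (Q : Type w) [AddCommGroup I] [Module R I] [MultiOps R ar I]
    [AddCommGroup M] [Module R M] [MultiOps R ar M]
    [AddCommGroup Q] [Module R Q] [MultiOps R ar Q] where
  incl : I →ₗ[R] M
  proj : M →ₗ[R] Q
  incl_op : ∀ (f : F) (b : Fin (ar f) → I),
    incl (mop R ar f b) = mop R ar f (fun j => incl (b j))
  proj_op : ∀ (f : F) (m : Fin (ar f) → M),
    proj (mop R ar f m) = mop R ar f (fun j => proj (m j))
  injective : Function.Injective incl
  surjective : Function.Surjective proj
  exact : ∀ m : M, proj m = 0 ↔ ∃ b : I, incl b = m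

section

variable {R : Type uR} [Ring R] {F : Type uF} {ar : F → ℕ}
  {I : Type*} {M : Type*} {Q : Type*} {A : Type*}
  [AddCommGroup I] [Module R I] [MultiOps R ar I]
  [AddCommGroup M] [Module R M] [MultiOps R ar M]
  [AddCommGroup Q] [Module R Q] [MultiOps R ar Q]
  [AddCommGroup A] [Module R A] [MultiOps R ar A]

/-- A lifting of `π : M → Q`: a set-theoretic section with `l 0 = 0`. -/
structure Extension.Lifting (E : Extension R ar I M Q) where
  l : Q → M
  proj_l : ∀ x, E.proj (l x) = x
  l_zero : l 0 = 0

/-- The element of `I` corresponding to an element of `ker π`. -/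
noncomputable def Extension.pull (E : Extension R ar I M Q) (m : M) (hm : E.proj m = 0) : I :=
  Classical.choose ((E.exact m).mp hm)

theorem Extension.incl_pull (E : Extension R ar I M Q) (m : M) (hm : E.proj m = 0) :
    E.incl (E.pull m hm) = m :=
  Classical.choose_spec ((E.exact m).mp hm)

/-- The factor sets `T` of the 2-cocycle determined by the extension and the lifting:
`T₊(x,y) = l(x) + l(y) - l(x+y)`, `Tᵣ(x) = r • l(x) - l(r • x)`, `T_f(x) = f^M(l(x)) - l(f^Q(x))`. -/
noncomputable def Extension.factorSets (E : Extension R ar I M Q) (L : E.Lifting) :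
    Cochain R ar Q I :=
  (fun x y => E.pull (L.l x + L.l y - L.l (x + y)) (by simp [L.proj_l]),
   fun r x => E.pull (r • L.l x - L.l (r • x)) (by simp [L.proj_l]),
   fun f x => E.pull (mop R ar f (fun j => L.l (x j)) - L.l (mop R ar f x))
    (by rw [map_sub, E.proj_op]; simp [L.proj_l]))

/-- The tuple with entry `b j ∈ I` for `j ∈ s` and entry `l (x j)` for `j ∉ s`. -/
def Extension.mix (E : Extension R ar I M Q) (L : E.Lifting) {n : ℕ} (s : Finset (Fin n))
    (x : Fin n → Q) (b : Fin n → I) (j : Fin n) : M :=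
  if j ∈ s then E.incl (b j) else L.l (x j)

theorem Extension.proj_mix (E : Extension R ar I M Q) (L : E.Lifting) (f : F)
    (s : Finset (Fin (ar f))) (hs : s.Nonempty) (x : Fin (ar f) → Q) (b : Fin (ar f) → I) :
    E.proj (mop R ar f (E.mix L s x b)) = 0 := by
  obtain ⟨j, hj⟩ := hs
  rw [E.proj_op]
  refine MultilinearMap.map_coord_zero _ j ?_
  rw [Extension.mix, if_pos hj]
  exact (E.exact _).mpr ⟨b j, rfl⟩

/-- The action terms `b(f,s)(x,b)` of the action of `Q` on `I` determined by the extension and the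
lifting: the value of `f^M` at the tuple `l(x)` with the entries in `s` replaced by those
of `b`. -/
noncomputable def Extension.bAct (E : Extension R ar I M Q) (L : E.Lifting) (f : F)
    (s : Finset (Fin (ar f))) (hs : s.Nonempty) (x : Fin (ar f) → Q) (b : Fin (ar f) → I) : I :=
  E.pull (mop R ar f (E.mix L s x b)) (E.proj_mix L f s hs x b)

variable {V : Variety R ar}

/-- The null submodule `A^I`, where `I` is identified with its image in `M`. -/
abbrev AffineDatum.nullI (D : AffineDatum V M A) (E : Extension R ar I M Q) : Submodule R A :=
  D.action.null (Set.range E.incl)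

/-- The action of `M` on `A^I`. -/
def AffineDatum.actM (D : AffineDatum V M A) (E : Extension R ar I M Q) :
    LinearAction R ar M (D.nullI E) :=
  D.action.onNull (Set.range E.incl)

/-- The action of `I` on `A^I`, by restriction. -/
def AffineDatum.actI (D : AffineDatum V M A) (E : Extension R ar I M Q) :
    LinearAction R ar I (D.nullI E) :=
  (D.actM E).comap E.incl (map_zero E.incl)

/-- The action `∗̂` of `Q` on `A^I`: `â(f,i)(x,a) = a(f,i)(l(x),a)`. -/
def AffineDatum.actQ (D : AffineDatum V M A) (E : Extension R ar I M Q) (L : E.Lifting) :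
    LinearAction R ar Q (D.nullI E) :=
  (D.actM E).comap L.l L.l_zero

/-- The derivations of the datum `(I,A^I,∗)` that satisfy the `□`-condition: for some
`h : Q → A^I`, for all `f` and all nonempty proper sets `s` of coordinates,
`d(b(f,s)(x,b)) = ∑_{i ∉ s} a(f,i)(l(x)_s[b], h(xᵢ)) + ∑_{i ∈ s} a(f,i)(l(x)_s[b], d(bᵢ))`. -/
def AffineDatum.squareDer (D : AffineDatum V M A) (E : Extension R ar I M Q) (L : E.Lifting) :
    AddSubgroup (Der (D.actI E)) where
  carrier := {d | ∃ h : Q → D.nullI E, ∀ (f : F) (s : Finset (Fin (ar f))) (hs : s.Nonempty),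
    s ≠ Finset.univ → ∀ (x : Fin (ar f) → Q) (b : Fin (ar f) → I),
      d.1 (E.bAct L f s hs x b) =
        (∑ i ∈ sᶜ, (D.actM E).act f i (E.mix L s x b) (h (x i))) +
        ∑ i ∈ s, (D.actM E).act f i (E.mix L s x b) (d.1 (b i))}
  zero_mem' := ⟨0, fun f s hs _ x b => by simp⟩
  add_mem' := by
    rintro d d' ⟨h, H⟩ ⟨h', H'⟩
    refine ⟨h + h', fun f s hs hs' x b => ?_⟩
    simp only [AddSubgroup.coe_add, Pi.add_apply, H f s hs hs' x b, H' f s hs hs' x b, map_add,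
      Finset.sum_add_distrib]
    abel
  neg_mem' := by
    rintro d ⟨h, H⟩
    refine ⟨-h, fun f s hs hs' x b => ?_⟩
    simp only [NegMemClass.coe_neg, Pi.neg_apply, H f s hs hs' x b, map_neg,
      Finset.sum_neg_distrib, neg_add]

/-- `H¹(I,A^I,∗)^□`: the classes of the derivations that satisfy the `□`-condition. -/
def AffineDatum.H1Square (D : AffineDatum V M A) (E : Extension R ar I M Q) (L : E.Lifting) :
    AddSubgroup (H1 (D.actI E)) :=
  (D.squareDer E L).map (QuotientAddGroup.mk' (PDer (D.actI E)))

end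

/-- Postcomposition `d ∘ T` of factor sets with a map. -/
def Cochain.post {R : Type*} {F : Type*} {ar : F → ℕ} {Q I A : Type*} (d : I → A)
    (T : Cochain R ar Q I) : Cochain R ar Q A :=
  (fun x y => d (T.1 x y), fun r x => d (T.2.1 r x), fun f x => d (T.2.2 f x))

/-- Precomposition `T ∘ π` of factor sets with a map. -/
def Cochain.pre {R : Type*} {F : Type*} {ar : F → ℕ} {Q M A : Type*}
    (T : Cochain R ar Q A) (π : M → Q) : Cochain R ar M A :=
  (fun x y => T.1 (π x) (π y), fun r x => T.2.1 r (π x), fun f x => T.2.2 f (fun j => π (x j)))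

end MultExp

open MultExp

/-!
The maps `I → M → Q` are homomorphisms along which the actions on `A^I` pull back to one another
(`IsActionHom`); for `M → Q` this is because a compatible action is additive in each argument from
the acting algebra, while an argument from `I` kills `A^I` (`IsCompatible.onNull_act_congr`).
Inflation and restriction are precomposition with such homomorphisms. A term witnessing that `d` is
principal may move the second coordinate after precomposition, but the difference of its two values
does not, and this repairs the witness (`isPrincipal_of_term`). The algebra `I` itself acts on `A^I`
without dependence on its elements, so that its only principal derivation is zero
(`AffineDatum.mkI_injective`) and a class in `H¹(I,A^I,∗)` is a single derivation.

The centre of the argument is the retraction `m ↦ m - l(π m)` of `M` onto `I`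
(`Extension.ret`), which fails to be a homomorphism exactly by the factor sets `T` and by the values
of operations at tuples mixing `I` and `l(Q)`. On `A^I` the square condition reduces to
equivariance in one argument and vanishing on two or more arguments from `I`
(`AffineDatum.squareDer_bAct`), whatever the map `h` in it. Expanding `f^M` multilinearly, one finds
that `m ↦ ⟨d (m - l(π m)), π m⟩` is a homomorphism from `M` to the crossed product of `A^I` and `Q`
with the factor sets `d ∘ T` (`AffineDatum.squareDer_crossed_eval`). Since `M` satisfies the
identities of `𝒱`, the family `d ∘ T` is a strictly compatible 2-cocycle.

Exactness then comes from explicit formulas: a derivation of `M` vanishing on `I` factors through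
`Q`; `d ∘ T = ∂h` makes `d (m - l(π m)) + h(π m)` a derivation of `M` extending `d`; the inflation
of `d ∘ T` is the coboundary of `-d (m - l(π m))`; and if the inflation of `S` is `∂g`, then
`d = -g|_I` has the square condition and `S - d ∘ T = ∂(g ∘ l)`.
-/

namespace MultExp

section

variable {R : Type*} [Ring R] {F : Type*} {ar : F → ℕ} {X Y B : Type*}
  [AddCommGroup X] [Module R X] [MultiOps R ar X]
  [AddCommGroup Y] [Module R Y] [MultiOps R ar Y]
  [AddCommGroup B] [Module R B]

/-! ### Derivations, crossed products and principal derivations -/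

theorem mem_Der_iff {α : LinearAction R ar X B} {d : X → B} :
    d ∈ Der α ↔ (∀ x y, d (x + y) = d x + d y) ∧ (∀ (r : R) (x : X), d (r • x) = r • d x) ∧
      ∀ (f : F) (x : Fin (ar f) → X), d (mop R ar f x) = ∑ i, α.act f i x (d (x i)) := by
  constructor
  · intro h
    have h : cobound α d = 0 := h
    refine ⟨fun x y => ?_, fun r x => ?_, fun f x => ?_⟩
    · exact (sub_eq_zero.mp (congrFun (congrFun (congrArg Prod.fst h) x) y)).symm
    · exact (sub_eq_zero.mp (congrFun (congrFun (congrArg (fun c => c.2.1) h) r) x)).symm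
    · exact (sub_eq_zero.mp (congrFun (congrFun (congrArg (fun c => c.2.2) h) f) x)).symm
  · rintro ⟨h1, h2, h3⟩
    change cobound α d = 0
    refine Prod.ext ?_ (Prod.ext ?_ ?_)
    · funext x y; exact sub_eq_zero.mpr (h1 x y).symm
    · funext r x; exact sub_eq_zero.mpr (h2 r x).symm
    · funext f x; exact sub_eq_zero.mpr (h3 f x).symm

theorem crossed_eval_snd (α : LinearAction R ar X B) (T : Cochain R ar X B) {W : Type*}
    (e : W → B × X) (t : Term R ar W) :
    ((crossed α T).eval e t).2 = (toRaw R ar X).eval (fun w => (e w).2) t := by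
  induction t with
  | var y => rfl
  | zero => rfl
  | add s t hs ht => simp only [RawAlg.eval, crossed, toRaw] at *; rw [hs, ht]
  | smul r t ht => simp only [RawAlg.eval, crossed, toRaw] at *; rw [ht]
  | op f ts h => simp only [RawAlg.eval, crossed, toRaw] at *; simp only [h]

/-- At variables with zero first coordinate, the first coordinate of the value of a term in the
crossed product consists of the summands involving a factor set. -/
theorem crossed_eval_zero (α : LinearAction R ar X B) (T : Cochain R ar X B) {W : Type*}
    (x : W → X) (t : Term R ar W) :
    (crossed α T).eval (fun w => (0, x w)) t = (strictPart α T x t, (toRaw R ar X).eval x t) := by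
  induction t with
  | var y => rfl
  | zero => rfl
  | add s t hs ht => simp only [RawAlg.eval, hs, ht]; rfl
  | smul r t ht => simp only [RawAlg.eval, ht]; rfl
  | op f ts h => simp only [RawAlg.eval, h]; rfl

/-- If two tuples from `B × 0` give values of a term `t(z,y)` that differ by `d`, then `d` is
principal: the term `t(z,y') - t(z,y) + z` witnesses this. -/
theorem isPrincipal_of_term (α : LinearAction R ar X B) {d : X → B} (h0 : d 0 = 0) {k : ℕ}
    (t : Term R ar (Option (Fin k))) (c e : Fin k → B × X) (hc : ∀ j, (c j).2 = 0)
    (he : ∀ j, (e j).2 = 0)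
    (h : ∀ z : B × X, ((crossed α 0).eval (fun o => o.elim z c) t).1 + d z.2 =
      ((crossed α 0).eval (fun o => o.elim z e) t).1) : IsPrincipal α d := by
  have hsnd : ∀ z : B × X, ((crossed α 0).eval (fun o => o.elim z c) t).2 =
      ((crossed α 0).eval (fun o => o.elim z e) t).2 := by
    intro z
    rw [crossed_eval_snd, crossed_eval_snd]
    congr 1
    funext o
    cases o with
    | none => rfl
    | some j => exact (hc j).trans (he j).symm
  obtain ⟨u, key⟩ : ∃ u : Term R ar (Option (Fin (k + k))),
      ∀ (p q : Fin k → B × X) (z : B × X),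
      (crossed α 0).eval (fun o => o.elim z (Fin.append p q)) u =
      (crossed α 0).eval (fun o => o.elim z p) t - (crossed α 0).eval (fun o => o.elim z q) t
        + z := by
    refine ⟨.add (.add (t.subst (fun o => .var (o.map (Fin.castAdd k))))
      (.smul (-1) (t.subst (fun o => .var (o.map (Fin.natAdd k)))))) (.var none),
      fun p q z => ?_⟩
    have h1 : (crossed α 0).eval (fun o => o.elim z (Fin.append p q))
        (t.subst (fun o => .var (o.map (Fin.castAdd k)))) =
        (crossed α 0).eval (fun o => o.elim z p) t := by
      rw [RawAlg.eval_subst]; congr 1; funext o; cases o <;> simp [RawAlg.eval]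
    have h2 : (crossed α 0).eval (fun o => o.elim z (Fin.append p q))
        (t.subst (fun o => .var (o.map (Fin.natAdd k)))) =
        (crossed α 0).eval (fun o => o.elim z q) t := by
      rw [RawAlg.eval_subst]; congr 1; funext o
      cases o with
      | none => rfl
      | some j => exact Fin.append_right p q j
    simp only [RawAlg.eval, h1, h2]
    refine Prod.ext ?_ ?_ <;> simp [crossed, sub_eq_add_neg]
  refine ⟨⟨k + k, u, Fin.append c e, Fin.append e e, ?_, ?_, fun z => ?_, fun z => ?_⟩, 0, ?_⟩
  · intro j; refine Fin.addCases (fun j => ?_) (fun j => ?_) j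
    · rw [Fin.append_left]; exact hc j
    · rw [Fin.append_right]; exact he j
  · intro j; refine Fin.addCases (fun j => ?_) (fun j => ?_) j
    · rw [Fin.append_left]; exact he j
    · rw [Fin.append_right]; exact he j
  · rw [key]
    refine Prod.ext ?_ ?_
    · simp only [stabMap, Prod.fst_add, Prod.fst_sub, ← h z]; abel
    · simp only [stabMap, Prod.snd_add, Prod.snd_sub, hsnd z]; abel
  · rw [key, sub_self, zero_add]
  · simp [stabMap, h0]

/-- If the action does not depend on the arguments from `X`, the only principal derivation is
zero. -/
theorem eq_zero_of_isPrincipal {α : LinearAction R ar X B}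
    (hα : ∀ f i x y, α.act f i x = α.act f i y) {d : X → B} (h0 : d 0 = 0)
    (hd : IsPrincipal α d) : d = 0 := by
  have key : ∀ {W : Type} (e e' : W → B × X), (∀ w, (e w).1 = (e' w).1) →
      ∀ t : Term R ar W, ((crossed α 0).eval e t).1 = ((crossed α 0).eval e' t).1 := by
    intro W e e' he t
    induction t with
    | var y => exact he y
    | zero => rfl
    | add s t hs ht => simp only [RawAlg.eval, crossed] at *; rw [hs, ht]; rfl
    | smul r t ht => simp only [RawAlg.eval, crossed] at *; rw [ht]; rfl
    | op f ts h =>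
      simp only [RawAlg.eval, crossed] at *
      simp only [h]
      refine congrArg₂ (· + ·) (Finset.sum_congr rfl fun i _ => ?_) rfl
      rw [hα]
  obtain ⟨⟨k, t, c, -, -, -, hc, -⟩, -⟩ := hd
  funext x
  have h1 := congrArg Prod.fst (hc (0, x))
  have h2 := congrArg Prod.fst (hc (0, 0))
  have h3 := key (fun o => o.elim (0, x) c) (fun o => o.elim (0, 0) c)
    (fun o => by cases o <;> rfl) t
  rw [h3, ← h2] at h1
  simpa [stabMap, h0] using h1

/-! ### Change of the acting algebra -/

/-- A homomorphism `φ : X → Y` along which the action `β` of `Y` pulls back to the action `α`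
of `X` on the same module. -/
structure IsActionHom (α : LinearAction R ar X B) (β : LinearAction R ar Y B)
    (φ : X →ₗ[R] Y) : Prop where
  map_op : ∀ (f : F) (x : Fin (ar f) → X), φ (mop R ar f x) = mop R ar f (fun j => φ (x j))
  act_comp : ∀ (f : F) (i : Fin (ar f)) (x : Fin (ar f) → X),
    β.act f i (fun j => φ (x j)) = α.act f i x

namespace IsActionHom

variable {α : LinearAction R ar X B} {β : LinearAction R ar Y B} {φ : X →ₗ[R] Y}

theorem eval_map (h : IsActionHom α β φ) {W : Type*} (x : W → X) (t : Term R ar W) :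
    (toRaw R ar Y).eval (fun w => φ (x w)) t = φ ((toRaw R ar X).eval x t) := by
  induction t with
  | var y => rfl
  | zero => exact (map_zero φ).symm
  | add s t hs ht => simp only [RawAlg.eval, hs, ht]; exact (map_add φ _ _).symm
  | smul r t ht => simp only [RawAlg.eval, ht]; exact (map_smul φ _ _).symm
  | op f ts ih => simp only [RawAlg.eval, ih]; exact (h.map_op f _).symm

/-- The map `id × φ` is a homomorphism of semidirect products. -/
theorem crossed_eval (h : IsActionHom α β φ) {W : Type*} (e : W → B × X) (t : Term R ar W) :
    (crossed β 0).eval (fun w => Prod.map id φ (e w)) t =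
      Prod.map id φ ((crossed α 0).eval e t) := by
  induction t with
  | var y => rfl
  | zero => exact Prod.ext rfl (map_zero φ).symm
  | add s t hs ht =>
    simp only [RawAlg.eval, hs, ht]; exact Prod.ext rfl (map_add φ _ _).symm
  | smul r t ht =>
    simp only [RawAlg.eval, ht]; exact Prod.ext rfl (map_smul φ _ _).symm
  | op f ts ih =>
    simp only [RawAlg.eval, ih]
    refine Prod.ext ?_ (h.map_op f _).symm
    simp only [crossed, Prod.map_fst, Prod.map_snd, h.act_comp]
    rfl

theorem isCompatible (h : IsActionHom α β φ) (hφ : Function.Surjective φ) {V : Variety R ar}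
    (hα : IsCompatible V α) : IsCompatible V β := by
  intro p hp e
  choose g hg using fun n => hφ (e n).2
  have he : e = fun n => Prod.map id φ ((e n).1, g n) := by
    funext n; exact Prod.ext rfl (hg n).symm
  rw [he, h.crossed_eval, h.crossed_eval, hα p hp]

theorem comp_mem_Der (h : IsActionHom α β φ) {d : Y → B} (hd : d ∈ Der β) : d ∘ φ ∈ Der α := by
  obtain ⟨h1, h2, h3⟩ := mem_Der_iff.mp hd
  refine mem_Der_iff.mpr ⟨fun x y => ?_, fun r x => ?_, fun f x => ?_⟩
  · simp [h1]
  · simp [h2]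
  · simp only [Function.comp_apply, h.map_op, h3, h.act_comp]

/-- The witnessing term for `d` cannot be reused for `d ∘ φ`, since the second coordinate of its
value need not be preserved; the difference of its two values can. -/
theorem isPrincipal_comp (h : IsActionHom α β φ) {d : Y → B} (h0 : d 0 = 0)
    (hd : IsPrincipal β d) : IsPrincipal α (d ∘ φ) := by
  obtain ⟨⟨k, t, c, e, hc, he, htc, hte⟩, -⟩ := hd
  have key : ∀ (c : Fin k → B × Y), (∀ j, (c j).2 = 0) → ∀ z : B × X,
      ((crossed α 0).eval (fun o => o.elim z fun j => ((c j).1, 0)) t).1 =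
      ((crossed β 0).eval (fun o => o.elim (Prod.map id φ z) c) t).1 := by
    intro c hc z
    have h1 := congrArg Prod.fst
      (h.crossed_eval (fun o : Option (Fin k) => o.elim z fun j => ((c j).1, 0)) t)
    refine h1.symm.trans (congrArg (fun e => ((crossed β 0).eval e t).1) ?_)
    funext o
    cases o with
    | none => rfl
    | some j => exact Prod.ext rfl ((map_zero φ).trans (hc j).symm)
  refine isPrincipal_of_term α (by simp [h0]) t (fun j => ((c j).1, 0)) (fun j => ((e j).1, 0))
    (fun _ => rfl) (fun _ => rfl) fun z => ?_
  rw [key c hc, key e he, ← htc, ← hte]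
  simp [stabMap]

theorem isPrincipal_of_comp (h : IsActionHom α β φ) (hφ : Function.Surjective φ) {d : Y → B}
    (h0 : d 0 = 0) (hd : IsPrincipal α (d ∘ φ)) : IsPrincipal β d := by
  obtain ⟨⟨k, t, c, e, hc, he, htc, hte⟩, -⟩ := hd
  have key : ∀ (c : Fin k → B × X) (z : B × X),
      (crossed β 0).eval (fun o => o.elim (Prod.map id φ z) fun j => Prod.map id φ (c j)) t =
      Prod.map id φ ((crossed α 0).eval (fun o => o.elim z c) t) := by
    intro c z
    rw [← h.crossed_eval]
    congr 1
    funext o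
    cases o <;> rfl
  have hmem : ∀ c : Fin k → B × X, (∀ j, c j ∈ {z : B × X | z.2 = 0}) →
      ∀ j, Prod.map id φ (c j) ∈ {z : B × Y | z.2 = 0} := by
    intro c hc j
    have hj : (c j).2 = 0 := hc j
    change φ (c j).2 = 0
    rw [hj, map_zero]
  refine ⟨⟨k, t, fun j => Prod.map id φ (c j), fun j => Prod.map id φ (e j), hmem c hc,
    hmem e he, fun z => ?_, fun z => ?_⟩, 0, by simp [stabMap, h0]⟩
  · obtain ⟨x, hx⟩ := hφ z.2
    have hz : z = Prod.map id φ (z.1, x) := Prod.ext rfl hx.symm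
    rw [hz, key, ← htc]
    rfl
  · obtain ⟨x, hx⟩ := hφ z.2
    have hz : z = Prod.map id φ (z.1, x) := Prod.ext rfl hx.symm
    rw [hz, key, ← hte]

/-- The homomorphism of first cohomology groups induced by precomposition. -/
def mapH1 (h : IsActionHom α β φ) : H1 β →+ H1 α :=
  QuotientAddGroup.map (PDer β) (PDer α)
    { toFun := fun d => (⟨d.1 ∘ φ, h.comp_mem_Der d.2⟩ : Der α)
      map_zero' := rfl
      map_add' := fun _ _ => rfl }
    fun d hd => h.isPrincipal_comp (Der.map_zero d) hd

theorem mapH1_mk (h : IsActionHom α β φ) (d : Der β) :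
    h.mapH1 (H1.mk d) = H1.mk ⟨d.1 ∘ φ, h.comp_mem_Der d.2⟩ := rfl

theorem mapH1_injective (h : IsActionHom α β φ) (hφ : Function.Surjective φ) :
    Function.Injective h.mapH1 := by
  refine (injective_iff_map_eq_zero _).mpr fun c => ?_
  induction c using QuotientAddGroup.induction_on with
  | H d =>
    intro hc
    rw [h.mapH1_mk] at hc
    exact (QuotientAddGroup.eq_zero_iff d).mpr
      (h.isPrincipal_of_comp hφ (Der.map_zero d) ((QuotientAddGroup.eq_zero_iff _).mp hc))

theorem strictPart_pre (h : IsActionHom α β φ) (T : Cochain R ar Y B) {W : Type*} (x : W → X)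
    (t : Term R ar W) :
    strictPart α (Cochain.pre T φ) x t = strictPart β T (fun w => φ (x w)) t := by
  induction t with
  | var y => rfl
  | zero => rfl
  | add s t hs ht => simp only [strictPart, hs, ht, h.eval_map]; rfl
  | smul r t ht => simp only [strictPart, ht, h.eval_map]; rfl
  | op f ts ih => simp only [strictPart, ih, h.eval_map, h.act_comp]; rfl

theorem pre_mem_Z2 (h : IsActionHom α β φ) {V : Variety R ar} {T : Cochain R ar Y B}
    (hT : T ∈ Z2 V β) : Cochain.pre T φ ∈ Z2 V α := by
  obtain ⟨h1, h2, h3, h4⟩ := hT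
  refine ⟨fun x => ⟨?_, ?_⟩, fun r => ?_, fun f x hx => ?_, fun p hp x => ?_⟩
  · simpa [Cochain.pre] using (h1 (φ x)).1
  · simpa [Cochain.pre] using (h1 (φ x)).2
  · simpa [Cochain.pre] using h2 r
  · obtain ⟨i, hi⟩ := hx
    exact h3 f _ ⟨i, by simp [hi]⟩
  · rw [h.strictPart_pre, h.strictPart_pre, h4 p hp]

theorem cobound_comp (h : IsActionHom α β φ) (g : Y → B) :
    cobound α (g ∘ φ) = Cochain.pre (cobound β g) φ := by
  refine Prod.ext ?_ (Prod.ext ?_ ?_)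
  · funext x y; simp [cobound, Cochain.pre]
  · funext r x; simp [cobound, Cochain.pre]
  · funext f x
    simp only [cobound, Cochain.pre, AddMonoidHom.coe_mk, ZeroHom.coe_mk, Function.comp_apply,
      h.map_op, h.act_comp]

theorem pre_mem_B2 (h : IsActionHom α β φ) {T : Cochain R ar Y B} (hT : T ∈ B2 β) :
    Cochain.pre T φ ∈ B2 α := by
  obtain ⟨g, hg, rfl⟩ := hT
  have hg : g 0 = 0 := hg
  refine ⟨g ∘ φ, ?_, h.cobound_comp g⟩
  change g (φ 0) = 0
  rw [map_zero, hg]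

/-- The homomorphism of second cohomology groups induced by precomposition. -/
def mapH2 (h : IsActionHom α β φ) (V : Variety R ar) : H2 V β →+ H2 V α :=
  QuotientAddGroup.map _ _
    { toFun := fun T => (⟨Cochain.pre T.1 φ, h.pre_mem_Z2 T.2⟩ : Z2 V α)
      map_zero' := rfl
      map_add' := fun _ _ => rfl }
    fun _ hT => h.pre_mem_B2 hT

theorem mapH2_mk (h : IsActionHom α β φ) {V : Variety R ar} (T : Z2 V β) :
    h.mapH2 V (H2.mk T) = H2.mk ⟨Cochain.pre T.1 φ, h.pre_mem_Z2 T.2⟩ := rfl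

end IsActionHom

theorem H2.mk_eq_zero_iff {V : Variety R ar} {α : LinearAction R ar X B} (T : Z2 V α) :
    H2.mk T = 0 ↔ T.1 ∈ B2 α :=
  QuotientAddGroup.eq_zero_iff T

end

/-! ### The action on the null submodule -/

theorem LinearAction.act_null_eq_zero {R : Type*} [Ring R] {F : Type*} {ar : F → ℕ}
    {X B : Type*} [AddCommGroup X] [AddCommGroup B] [Module R B]
    {α : LinearAction R ar X B} {K : Set X} (f : F)
    {i j : Fin (ar f)} (hj : j ≠ i) {x : Fin (ar f) → X} (hx : x j ∈ K) (b : α.null K) :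
    (α.onNull K).act f i x b = 0 :=
  Subtype.ext (b.2 [⟨f, i, x⟩] ⟨_, List.mem_singleton_self _, j, hj, hx⟩)

section

variable {R : Type*} [Ring R] {F : Type*} {ar : F → ℕ} {X B : Type*}
  [AddCommGroup X] [Module R X] [MultiOps R ar X] [AddCommGroup B] [Module R B]

/-- A multilinear operation of arity at least two vanishes on an abelian algebra. -/
theorem IsAbelianAlg.mop_eq_zero {A : Type*} [AddCommGroup A] [Module R A] [MultiOps R ar A]
    (hA : IsAbelianAlg R ar A) (f : F) {i j : Fin (ar f)} (hij : i ≠ j) (a : Fin (ar f) → A) :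
    mop R ar f a = 0 := by
  -- The term condition for `f`, separating the coordinate `i` from all the others: at
  -- `0` in coordinate `i` the value does not depend on the others.
  let t : Term R ar (Fin 1 ⊕ Fin (ar f)) :=
    .op f (fun k => if k = i then .var (.inl 0) else .var (.inr k))
  have ht : ∀ (x : Fin 1 → A) (y : Fin (ar f) → A), (toRaw R ar A).eval (Sum.elim x y) t =
      mop R ar f (Function.update y i (x 0)) := by
    intro x y
    refine congrArg (fun m => mop R ar f m) ?_
    funext k
    by_cases hk : k = i
    · subst hk; simp [RawAlg.eval]
    · simp [hk, RawAlg.eval]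
  have h := hA 1 (ar f) t (fun _ => 0) (fun _ => a i) a (fun _ => 0) (by
    rw [ht, ht]
    exact (MultilinearMap.map_update_zero _ a i).trans
      (MultilinearMap.map_update_zero _ (fun _ => 0) i).symm)
  rw [ht, ht, Function.update_eq_self] at h
  rw [h]
  exact MultilinearMap.map_coord_zero _ j (by simp [hij.symm])

/-- In a compatible action, action terms are additive in each argument from the acting algebra. -/
theorem IsCompatible.act_update_add {V : Variety R ar} {α : LinearAction R ar X B}
    (hα : IsCompatible V α) (f : F) {i k : Fin (ar f)} (hk : k ≠ i) (x : Fin (ar f) → X)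
    (u v : X) (b : B) :
    α.act f i (Function.update x k (u + v)) b =
      α.act f i (Function.update x k u) b + α.act f i (Function.update x k v) b := by
  classical
  let e : ℕ → B × X := fun n => if h : n < ar f then (if (⟨n, h⟩ : Fin (ar f)) = i then b else 0,
    x ⟨n, h⟩) else if n = ar f then (0, u) else (0, v)
  have h := congrArg Prod.fst (hα _ (V.base _ _ (.linear f k 1)) e)
  have e1 : ∀ j : Fin (ar f), e j = (if j = i then b else 0, x j) := fun j => by simp [e]
  have e2 : e (ar f) = (0, u) := by simp [e]
  have e3 : e (ar f + 1) = (0, v) := by simp [e]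
  -- The value of `f` at the tuple of variables with the entry `k` replaced by `(0, y)`.
  have key : ∀ (τ : Term R ar ℕ) (y : X), (crossed α 0).eval e τ = (0, y) →
      ((crossed α 0).eval e (.op f (Function.update (fun j : Fin (ar f) => Term.var j.val) k
        τ))).1 = α.act f i (Function.update x k y) b := by
    intro τ y hτ
    have hz : (fun j => (crossed α 0).eval e
        (Function.update (fun j : Fin (ar f) => Term.var j.val) k τ j)) =
        fun j => (if j = i then b else 0, Function.update x k y j) := by
      funext j
      by_cases hj : j = k
      · subst hj; simp [hτ, hk]
      · simp [hj, RawAlg.eval, e1]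
    rw [RawAlg.eval, hz]
    refine (add_zero _).trans ?_
    rw [Finset.sum_eq_single i]
    · simp
    · intro j _ hj; simp [hj]
    · simp
  rw [key _ (u + v) (by simp [RawAlg.eval, crossed, e2, e3])] at h
  rw [h]
  have k1 := key (.var (ar f)) u e2
  have k2 := key (.var (ar f + 1)) v e3
  rw [← k1, ← k2]
  simp [RawAlg.eval, crossed]

/-- The action of `x` on `B^K` depends only on the classes of the entries of `x` modulo `K`. -/
theorem IsCompatible.onNull_act_congr {V : Variety R ar} {α : LinearAction R ar X B}
    (hα : IsCompatible V α) {K : Set X} (f : F) (i : Fin (ar f)) {x y : Fin (ar f) → X}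
    (hxy : ∀ j, x j - y j ∈ K) : (α.onNull K).act f i x = (α.onNull K).act f i y := by
  classical
  suffices h : ∀ s : Finset (Fin (ar f)),
      (α.onNull K).act f i (s.piecewise x y) = (α.onNull K).act f i y by
    simpa using h Finset.univ
  intro s
  induction s using Finset.induction_on with
  | empty => simp
  | insert k s hk ih =>
    rw [Finset.piecewise_insert, ← ih]
    by_cases hki : k = i
    · subst hki
      exact LinearAction.act_indep _ _ _ _ _ fun j hj => by simp [hj]
    · refine LinearMap.ext fun b => ?_
      set z := s.piecewise x y with hz
      have hzk : z k = y k := by simp [hz, hk]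
      have h0 := LinearAction.act_null_eq_zero (α := α) (K := K) f hki
        (x := Function.update z k (x k - y k)) (by simpa using hxy k) b
      have h1 := hα.act_update_add f hki z (x k - y k) (y k) (b : B)
      rw [sub_add_cancel, ← hzk, Function.update_eq_self] at h1
      rw [hzk] at h1
      have h0' : α.act f i (Function.update z k (x k - y k)) (b : B) = 0 := congrArg Subtype.val h0
      rw [h0', zero_add] at h1
      exact Subtype.ext h1

theorem IsCompatible.onNull {V : Variety R ar} {α : LinearAction R ar X B}
    (hα : IsCompatible V α) (K : Set X) : IsCompatible V (α.onNull K) := by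
  have key : ∀ (e : ℕ → α.null K × X) (t : Term R ar ℕ),
      (crossed α 0).eval (fun n => ((e n).1.1, (e n).2)) t =
        Prod.map Subtype.val id ((crossed (α.onNull K) 0).eval e t) := by
    intro e t
    induction t with
    | var y => rfl
    | zero => rfl
    | add s t hs ht => simp only [RawAlg.eval, hs, ht]; rfl
    | smul r t ht => simp only [RawAlg.eval, ht]; rfl
    | op f ts ih =>
      simp only [RawAlg.eval, ih]
      refine Prod.ext ?_ rfl
      simp [crossed, LinearAction.onNull]
  intro p hp e
  refine (Subtype.val_injective.prodMap Function.injective_id) ?_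
  rw [← key, ← key, hα p hp]

end

section

variable {R : Type*} [Ring R] {F : Type*} {ar : F → ℕ} {V : Variety R ar} {I M Q A : Type*}
  [AddCommGroup I] [Module R I] [MultiOps R ar I]
  [AddCommGroup M] [Module R M] [MultiOps R ar M]
  [AddCommGroup Q] [Module R Q] [MultiOps R ar Q]
  [AddCommGroup A] [Module R A] [MultiOps R ar A]
  (D : AffineDatum V M A) (E : Extension R ar I M Q) (L : E.Lifting)

/-! ### Inflation and restriction as changes of the acting algebra -/

/-- An operation of arity one is an action term on `A`, and the others vanish on `A`. -/
theorem AffineDatum.mop_mem_nullI (har : ∀ f, 1 ≤ ar f) (f : F) (a : Fin (ar f) → A)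
    (ha : ∀ j, a j ∈ D.nullI E) : mop R ar f a ∈ D.nullI E := by
  let i : Fin (ar f) := ⟨0, har f⟩
  rcases (har f).eq_or_lt with h1 | h2
  · have hsub : Subsingleton (Fin (ar f)) := by rw [← h1]; infer_instance
    have ha' : a = fun _ => a i := funext fun j => congrArg a (Subsingleton.elim j i)
    rw [ha', ← D.act_unary f i h1.symm (fun _ => 0)]
    exact D.action.act_mem_null _ f i _ (ha i)
  · rw [D.abelian.mop_eq_zero f (i := i) (j := ⟨1, h2⟩) (by simp [i])]
    exact Submodule.zero_mem _

theorem AffineDatum.actM_congr (f : F) (i : Fin (ar f)) {x y : Fin (ar f) → M}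
    (hxy : ∀ j, E.proj (x j) = E.proj (y j)) : (D.actM E).act f i x = (D.actM E).act f i y :=
  D.compatible.onNull_act_congr f i fun j => (E.exact _).mp (by rw [map_sub, hxy j, sub_self])

theorem AffineDatum.actM_eq_zero (f : F) {i j : Fin (ar f)} (hj : j ≠ i) {x : Fin (ar f) → M}
    (hx : E.proj (x j) = 0) : (D.actM E).act f i x = 0 :=
  LinearMap.ext fun a => LinearAction.act_null_eq_zero f hj ((E.exact _).mp hx) a

/-- The action `∗̂` does not depend on the lifting: `m` and `l(π m)` differ by an element of `I`. -/
theorem AffineDatum.isActionHom_proj : IsActionHom (D.actM E) (D.actQ E L) E.proj where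
  map_op := E.proj_op
  act_comp f i _ := D.actM_congr E f i fun _ => L.proj_l _

theorem AffineDatum.isActionHom_incl : IsActionHom (D.actI E) (D.actM E) E.incl where
  map_op := E.incl_op
  act_comp _ _ _ := rfl

variable {E} in
theorem Extension.proj_incl (b : I) : E.proj (E.incl b) = 0 := (E.exact _).mpr ⟨b, rfl⟩

theorem AffineDatum.actI_congr (f : F) (i : Fin (ar f)) (x y : Fin (ar f) → I) :
    (D.actI E).act f i x = (D.actI E).act f i y :=
  D.actM_congr E f i fun j => by rw [E.proj_incl, E.proj_incl]

/-- Since `I` acts on `A^I` with no dependence on its elements, the group of principal derivations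
of `I` is trivial, and a class in `H¹(I,A^I,∗)` is a single derivation. -/
theorem AffineDatum.mkI_injective : Function.Injective (H1.mk (α := D.actI E)) := by
  have h := (injective_iff_map_eq_zero (QuotientAddGroup.mk' (PDer (D.actI E)))).mpr fun d hd =>
    Subtype.ext (eq_zero_of_isPrincipal (D.actI_congr E) (Der.map_zero d)
      ((QuotientAddGroup.eq_zero_iff d).mp hd))
  exact h

/-! ### The retraction onto `I` attached to a lifting -/

theorem Extension.incl_bAct (f : F) (s : Finset (Fin (ar f))) (hs : s.Nonempty)
    (x : Fin (ar f) → Q) (b : Fin (ar f) → I) :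
    E.incl (E.bAct L f s hs x b) = mop R ar f (E.mix L s x b) :=
  E.incl_pull _ _

/-- The `I`-component `m - l(π m)` of an element `m` of `M`. -/
noncomputable def Extension.ret (m : M) : I :=
  E.pull (m - L.l (E.proj m)) (by simp [L.proj_l])

theorem Extension.incl_ret (m : M) : E.incl (E.ret L m) = m - L.l (E.proj m) :=
  E.incl_pull _ _

theorem Extension.incl_ret_add (m : M) : E.incl (E.ret L m) + L.l (E.proj m) = m := by
  rw [E.incl_ret, sub_add_cancel]

theorem Extension.ret_incl (b : I) : E.ret L (E.incl b) = b :=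
  E.injective (by rw [E.incl_ret, E.proj_incl, L.l_zero, sub_zero])

theorem Extension.ret_lift (x : Q) : E.ret L (L.l x) = 0 :=
  E.injective (by rw [E.incl_ret, L.proj_l, sub_self, map_zero])

theorem Extension.incl_factorSets_add (x y : Q) :
    E.incl ((E.factorSets L).1 x y) = L.l x + L.l y - L.l (x + y) :=
  E.incl_pull _ (by simp [L.proj_l])

theorem Extension.incl_factorSets_smul (r : R) (x : Q) :
    E.incl ((E.factorSets L).2.1 r x) = r • L.l x - L.l (r • x) :=
  E.incl_pull _ (by simp [L.proj_l])

theorem Extension.incl_factorSets_op (f : F) (x : Fin (ar f) → Q) :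
    E.incl ((E.factorSets L).2.2 f x) =
      mop R ar f (fun j => L.l (x j)) - L.l (mop R ar f x) :=
  E.incl_pull _ (by rw [map_sub, E.proj_op]; simp [L.proj_l])

theorem Extension.ret_add (m n : M) : E.ret L (m + n) =
    E.ret L m + E.ret L n + (E.factorSets L).1 (E.proj m) (E.proj n) := by
  apply E.injective
  simp only [map_add, E.incl_ret, E.incl_factorSets_add]
  abel

theorem Extension.ret_smul (r : R) (m : M) : E.ret L (r • m) =
    r • E.ret L m + (E.factorSets L).2.1 r (E.proj m) := by
  apply E.injective
  simp only [map_add, map_smul, E.incl_ret, E.incl_factorSets_smul, smul_sub]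
  abel

/-- Multilinear expansion of `f^M` at the tuple with entries `mⱼ = ret mⱼ + l(π mⱼ)`. -/
theorem Extension.ret_op (f : F) (m : Fin (ar f) → M) : E.ret L (mop R ar f m) =
    (∑ s : Finset (Fin (ar f)), if hs : s.Nonempty then
      E.bAct L f s hs (fun j => E.proj (m j)) (fun j => E.ret L (m j)) else 0) +
    (E.factorSets L).2.2 f (fun j => E.proj (m j)) := by
  classical
  apply E.injective
  have hm : m = (fun j => E.incl (E.ret L (m j))) + fun j => L.l (E.proj (m j)) :=
    funext fun j => (E.incl_ret_add L (m j)).symm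
  have hmix : ∀ s : Finset (Fin (ar f)),
      s.piecewise (fun j => E.incl (E.ret L (m j))) (fun j => L.l (E.proj (m j))) =
        E.mix L s (fun j => E.proj (m j)) (fun j => E.ret L (m j)) := by
    intro s
    funext j
    simp only [Finset.piecewise, Extension.mix]
  rw [E.incl_ret, map_add, map_sum, E.incl_factorSets_op, E.proj_op]
  have hexp : mop R ar f m = ∑ s : Finset (Fin (ar f)),
      mop R ar f (E.mix L s (fun j => E.proj (m j)) (fun j => E.ret L (m j))) := by
    conv_lhs => rw [hm]
    exact (MultilinearMap.map_add_univ _ _ _).trans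
      (Finset.sum_congr rfl fun s _ => congrArg (fun m => mop R ar f m) (hmix s))
  rw [hexp, ← add_sub_assoc]
  congr 1
  rw [← Finset.sum_erase_add _ _ (Finset.mem_univ ∅)]
  conv_rhs => rw [← Finset.sum_erase_add _ _ (Finset.mem_univ ∅)]
  have h0 : E.mix L ∅ (fun j => E.proj (m j)) (fun j => E.ret L (m j)) =
      fun j => L.l (E.proj (m j)) := funext fun j => by simp [Extension.mix]
  rw [h0]
  simp only [Finset.not_nonempty_empty, dif_neg, not_false_eq_true, map_zero, add_zero]
  congr 1
  refine Finset.sum_congr rfl fun s hs => ?_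
  have hs : s.Nonempty := Finset.nonempty_iff_ne_empty.mpr (Finset.ne_of_mem_erase hs)
  rw [dif_pos hs, E.incl_bAct]

/-! ### The square condition and transgression -/

variable {D E L}

/-- The square condition says that `d` is equivariant on the coordinates where the tuple has one
entry from `I`, and that it kills the values of `f^M` with more than one entry from `I`: all other
action terms of the condition have an argument from `I`, so they vanish on `A^I`. -/
theorem AffineDatum.squareDer_bAct {d : Der (D.actI E)} (hd : d ∈ D.squareDer E L) (f : F)
    (s : Finset (Fin (ar f))) (hs : s.Nonempty) (x : Fin (ar f) → Q) (b : Fin (ar f) → I) :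
    d.1 (E.bAct L f s hs x b) = ∑ i, if s = {i} then (D.actQ E L).act f i x (d.1 (b i)) else 0 := by
  classical
  have hproj : ∀ j ∈ s, E.proj (E.mix L s x b j) = 0 := fun j hj => by
    rw [Extension.mix, if_pos hj, E.proj_incl]
  have hout : ∑ i ∈ sᶜ, (if s = {i} then (D.actQ E L).act f i x (d.1 (b i)) else 0) = 0 := by
    refine Finset.sum_eq_zero fun i hi => if_neg ?_
    rintro rfl
    exact Finset.mem_compl.mp hi (Finset.mem_singleton_self i)
  have hin : ∀ i ∈ s, (D.actM E).act f i (E.mix L s x b) (d.1 (b i)) =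
      if s = {i} then (D.actQ E L).act f i x (d.1 (b i)) else 0 := by
    intro i hi
    split_ifs with h
    · refine congrArg (fun g : D.nullI E →ₗ[R] D.nullI E => g (d.1 (b i)))
        ((D.actM E).act_indep f i _ _ fun j hj => ?_)
      rw [Extension.mix, if_neg (by rw [h]; simpa using hj)]
    · obtain ⟨j, hj, hji⟩ : ∃ j ∈ s, j ≠ i := by
        by_contra! hcon
        exact h (Finset.eq_singleton_iff_unique_mem.mpr ⟨hi, hcon⟩)
      rw [D.actM_eq_zero E f hji (hproj j hj), LinearMap.zero_apply]
  rw [← Finset.sum_add_sum_compl s, hout, add_zero, ← Finset.sum_congr rfl hin]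
  by_cases hs' : s = Finset.univ
  · have hmix : E.mix L s x b = fun j => E.incl (b j) := funext fun j => by
      simp [Extension.mix, hs']
    have hb : E.bAct L f s hs x b = mop R ar f b :=
      E.injective (by rw [E.incl_bAct, hmix, E.incl_op])
    rw [hb, (mem_Der_iff.mp d.2).2.2, hmix, hs']
    rfl
  · obtain ⟨h, H⟩ := hd
    rw [H f s hs hs', add_eq_right]
    refine Finset.sum_eq_zero fun i hi => ?_
    obtain ⟨j, hj⟩ := hs
    have hji : j ≠ i := by rintro rfl; exact Finset.mem_compl.mp hi hj
    rw [D.actM_eq_zero E f hji (hproj j hj), LinearMap.zero_apply]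

theorem AffineDatum.squareDer_ret_op {d : Der (D.actI E)} (hd : d ∈ D.squareDer E L) (f : F)
    (m : Fin (ar f) → M) : d.1 (E.ret L (mop R ar f m)) =
      (∑ i, (D.actM E).act f i m (d.1 (E.ret L (m i)))) +
        d.1 ((E.factorSets L).2.2 f (fun j => E.proj (m j))) := by
  classical
  rw [E.ret_op, Der.map_add]
  congr 1
  let g : I →+ D.nullI E := AddMonoidHom.mk' d.1 (Der.map_add d)
  change g _ = _
  have hg : ∀ s : Finset (Fin (ar f)), g (if hs : s.Nonempty then
      E.bAct L f s hs (fun j => E.proj (m j)) (fun j => E.ret L (m j)) else 0) =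
      ∑ i, if s = {i} then (D.actM E).act f i m (d.1 (E.ret L (m i))) else 0 := by
    intro s
    simp only [← (D.isActionHom_proj E L).act_comp]
    split_ifs with hs
    · exact AffineDatum.squareDer_bAct hd f s hs _ _
    · rw [map_zero]
      refine (Finset.sum_eq_zero fun i _ => if_neg ?_).symm
      rintro rfl
      exact hs (Finset.singleton_nonempty i)
  rw [map_sum, Finset.sum_congr rfl fun s _ => hg s, Finset.sum_comm]
  exact Finset.sum_congr rfl fun i _ => by simp

/-- For `d` with the square condition, `m ↦ ⟨d (ret m), π m⟩` is a homomorphism of `M` to the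
crossed product of `A^I` and `Q` with the factor sets `d ∘ T`. -/
theorem AffineDatum.squareDer_crossed_eval {d : Der (D.actI E)} (hd : d ∈ D.squareDer E L)
    {W : Type*} (e : W → M) (t : Term R ar W) :
    (crossed (D.actQ E L) (Cochain.post d.1 (E.factorSets L))).eval
        (fun w => (d.1 (E.ret L (e w)), E.proj (e w))) t =
      (d.1 (E.ret L ((toRaw R ar M).eval e t)), E.proj ((toRaw R ar M).eval e t)) := by
  obtain ⟨h1, h2, h3⟩ := mem_Der_iff.mp d.2
  have hproj := D.isActionHom_proj E L
  induction t with
  | var y => rfl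
  | zero =>
    refine Prod.ext ?_ (map_zero E.proj).symm
    change 0 = d.1 (E.ret L 0)
    rw [← L.l_zero, E.ret_lift, Der.map_zero]
  | add s t hs ht =>
    simp only [RawAlg.eval, hs, ht]
    refine Prod.ext ?_ (map_add E.proj _ _).symm
    exact (by rw [E.ret_add, h1, h1]; rfl : d.1 (E.ret L (_ + _)) = _).symm
  | smul r t ht =>
    simp only [RawAlg.eval, ht]
    refine Prod.ext ?_ (map_smul E.proj _ _).symm
    exact (by rw [E.ret_smul, h1, h2]; rfl : d.1 (E.ret L (_ • _)) = _).symm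
  | op f ts ih =>
    simp only [RawAlg.eval, ih]
    refine Prod.ext ?_ (E.proj_op f _).symm
    refine Eq.trans ?_ (AffineDatum.squareDer_ret_op hd f _).symm
    simp only [← hproj.act_comp]
    rfl

theorem AffineDatum.post_mem_Z2 (hM : V.Mem M) {d : Der (D.actI E)}
    (hd : d ∈ D.squareDer E L) : Cochain.post d.1 (E.factorSets L) ∈ Z2 V (D.actQ E L) := by
  have hpost : ∀ {b : I}, b = 0 → d.1 b = 0 := by rintro _ rfl; exact Der.map_zero d
  refine ⟨fun x => ⟨hpost ?_, hpost ?_⟩, fun r => hpost ?_, fun f x hx => hpost ?_,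
    fun p hp x => ?_⟩
  · exact E.injective (by rw [E.incl_factorSets_add]; simp [L.l_zero])
  · exact E.injective (by rw [E.incl_factorSets_add]; simp [L.l_zero])
  · exact E.injective (by rw [E.incl_factorSets_smul]; simp [L.l_zero])
  · obtain ⟨i, hi⟩ := hx
    apply E.injective
    have h1 : mop R ar f (fun j => L.l (x j)) = 0 :=
      MultilinearMap.map_coord_zero _ i (by rw [hi, L.l_zero])
    have h2 : mop R ar f x = 0 := MultilinearMap.map_coord_zero _ i hi
    rw [E.incl_factorSets_op, h1, h2, L.l_zero, sub_zero, map_zero]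
  · -- An identity of `M` at the tuple `l(x)` is carried by the homomorphism to the same identity
    -- of the crossed product at the tuple `⟨0, x⟩`.
    have key : ∀ t, strictPart (D.actQ E L) (Cochain.post d.1 (E.factorSets L)) x t =
        d.1 (E.ret L ((toRaw R ar M).eval (fun n => L.l (x n)) t)) := by
      intro t
      have h := AffineDatum.squareDer_crossed_eval hd (fun n => L.l (x n)) t
      simp only [E.ret_lift, Der.map_zero, L.proj_l, crossed_eval_zero] at h
      exact congrArg Prod.fst h
    rw [key, key, hM p hp]

variable (D E L) in
/-- Transgression as a homomorphism on the derivations with the square condition. -/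
noncomputable def AffineDatum.transgression (hM : V.Mem M) :
    D.squareDer E L →+ H2 V (D.actQ E L) where
  toFun d := H2.mk ⟨Cochain.post d.1.1 (E.factorSets L), AffineDatum.post_mem_Z2 hM d.2⟩
  map_zero' := rfl
  map_add' _ _ := rfl

variable (D E L) in
/-- The derivations with the square condition are their classes, by the triviality of the principal
derivations. -/
noncomputable def AffineDatum.squareEquiv : D.squareDer E L ≃+ D.H1Square E L :=
  AddSubgroup.equivMapOfInjective _ _ (D.mkI_injective E)

/-- The restriction of a derivation of `M` has the square condition, with `h = d ∘ l`. -/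
theorem AffineDatum.comp_incl_mem_squareDer (d : Der (D.actM E)) :
    (⟨d.1 ∘ E.incl, (D.isActionHom_incl E).comp_mem_Der d.2⟩ : Der (D.actI E)) ∈
      D.squareDer E L := by
  classical
  refine ⟨fun x => d.1 (L.l x), fun f s hs _ x b => ?_⟩
  change d.1 (E.incl _) = _
  rw [E.incl_bAct, (mem_Der_iff.mp d.2).2.2, ← Finset.sum_add_sum_compl s,
    add_comm]
  congr 1
  · refine Finset.sum_congr rfl fun i hi => ?_
    rw [show E.mix L s x b i = L.l (x i) from if_neg (Finset.mem_compl.mp hi)]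
  · refine Finset.sum_congr rfl fun i hi => ?_
    rw [show E.mix L s x b i = E.incl (b i) from if_pos hi]
    rfl

/-! ### Exactness -/

/-- A derivation of `M` that vanishes on `I` factors through a derivation of `Q`. -/
theorem AffineDatum.exists_comp_proj_eq (d : Der (D.actM E)) (hd : ∀ b, d.1 (E.incl b) = 0) :
    ∃ d' : Der (D.actQ E L), d'.1 ∘ E.proj = d.1 := by
  have hp := D.isActionHom_proj E L
  obtain ⟨h1, h2, h3⟩ := mem_Der_iff.mp d.2
  have hl : ∀ m, d.1 (L.l (E.proj m)) = d.1 m := by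
    intro m
    conv_rhs => rw [← E.incl_ret_add L m, h1, hd, zero_add]
  have hl' : ∀ {x m}, x = E.proj m → d.1 (L.l x) = d.1 m := by rintro _ m rfl; exact hl m
  refine ⟨⟨fun x => d.1 (L.l x), mem_Der_iff.mpr ⟨fun x y => ?_, fun r x => ?_, fun f x => ?_⟩⟩,
    funext hl⟩
  · rw [← h1]; exact hl' (by rw [map_add, L.proj_l, L.proj_l])
  · rw [← h2]; exact hl' (by rw [map_smul, L.proj_l])
  · refine (hl' (m := mop R ar f fun j => L.l (x j)) ?_).trans (h3 f _)
    rw [E.proj_op]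
    simp only [L.proj_l]

/-- The transgression of the restriction of `d` is the coboundary of `d ∘ l`. -/
theorem AffineDatum.post_comp_incl (d : Der (D.actM E)) :
    Cochain.post (d.1 ∘ E.incl) (E.factorSets L) = cobound (D.actQ E L) (fun x => d.1 (L.l x)) := by
  obtain ⟨h1, h2, h3⟩ := mem_Der_iff.mp d.2
  have hsub : ∀ x y, d.1 (x - y) = d.1 x - d.1 y := fun x y => by
    rw [eq_sub_iff_add_eq, ← h1, sub_add_cancel]
  refine Prod.ext ?_ (Prod.ext ?_ ?_)
  · funext x y
    change d.1 (E.incl _) = d.1 _ + d.1 _ - d.1 _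
    rw [E.incl_factorSets_add, hsub, h1]
  · funext r x
    change d.1 (E.incl _) = r • d.1 _ - d.1 _
    rw [E.incl_factorSets_smul, hsub, h2]
  · funext f x
    change d.1 (E.incl _) = _ - d.1 _
    rw [E.incl_factorSets_op, hsub, h3]
    rfl

/-- If `d ∘ T` is the coboundary of `h`, then `d` is the restriction of the derivation
`m ↦ d (m - l(π m)) + h(π m)` of `M`. -/
theorem AffineDatum.exists_comp_incl_eq {d : Der (D.actI E)} (hd : d ∈ D.squareDer E L)
    (hT : Cochain.post d.1 (E.factorSets L) ∈ B2 (D.actQ E L)) :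
    ∃ d' : Der (D.actM E), d'.1 ∘ E.incl = d.1 := by
  obtain ⟨h, h0, hh⟩ := hT
  have h0 : h 0 = 0 := h0
  obtain ⟨h1, h2, h3⟩ := mem_Der_iff.mp d.2
  have t1 : ∀ x y, d.1 ((E.factorSets L).1 x y) = h x + h y - h (x + y) := fun x y =>
    (congrFun (congrFun (congrArg Prod.fst hh) x) y).symm
  have t2 : ∀ r x, d.1 ((E.factorSets L).2.1 r x) = r • h x - h (r • x) := fun r x =>
    (congrFun (congrFun (congrArg (fun c => c.2.1) hh) r) x).symm
  have t3 : ∀ f x, d.1 ((E.factorSets L).2.2 f x) =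
      (∑ i, (D.actQ E L).act f i x (h (x i))) - h (mop R ar f x) := fun f x =>
    (congrFun (congrFun (congrArg (fun c => c.2.2) hh) f) x).symm
  refine ⟨⟨fun m => d.1 (E.ret L m) + h (E.proj m), mem_Der_iff.mpr
    ⟨fun m n => ?_, fun r m => ?_, fun f m => ?_⟩⟩, funext fun b => ?_⟩
  · rw [E.ret_add, h1, h1, t1, map_add]; abel
  · rw [E.ret_smul, h1, h2, t2, map_smul, smul_add]; abel
  · rw [AffineDatum.squareDer_ret_op hd, t3, E.proj_op]
    simp only [map_add, Finset.sum_add_distrib, (D.isActionHom_proj E L).act_comp]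
    abel
  · simp [E.ret_incl, E.proj_incl, h0]

/-- The inflation of `d ∘ T` is the coboundary of `m ↦ -d (m - l(π m))`. -/
theorem AffineDatum.pre_post_eq {d : Der (D.actI E)} (hd : d ∈ D.squareDer E L) :
    Cochain.pre (Cochain.post d.1 (E.factorSets L)) E.proj =
      cobound (D.actM E) (fun m => -d.1 (E.ret L m)) := by
  obtain ⟨h1, h2, h3⟩ := mem_Der_iff.mp d.2
  refine Prod.ext ?_ (Prod.ext ?_ ?_)
  · funext m n
    change d.1 _ = -d.1 _ + -d.1 _ - -d.1 _
    rw [E.ret_add, h1, h1]; abel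
  · funext r m
    change d.1 _ = r • -d.1 _ - -d.1 _
    rw [E.ret_smul, h1, h2, smul_neg]; abel
  · funext f m
    change d.1 _ = (∑ i, (D.actM E).act f i m (-d.1 (E.ret L (m i)))) - -d.1 _
    rw [AffineDatum.squareDer_ret_op hd]
    simp only [map_neg, Finset.sum_neg_distrib]
    abel

/-- If the inflation of a 2-cocycle `S` is the coboundary of `g`, then `d = -g|_I` is a derivation
with the square condition, and `S` differs from `d ∘ T` by the coboundary of `g ∘ l`. -/
theorem AffineDatum.exists_sub_post_mem_B2 (har : ∀ f, 1 ≤ ar f) {S : Cochain R ar Q (D.nullI E)}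
    (hZ : S ∈ Z2 V (D.actQ E L)) (hS : Cochain.pre S E.proj ∈ B2 (D.actM E)) :
    ∃ d ∈ D.squareDer E L, S - Cochain.post d.1 (E.factorSets L) ∈ B2 (D.actQ E L) := by
  classical
  obtain ⟨s1, s2, s3, -⟩ := hZ
  obtain ⟨g, g0, hg⟩ := hS
  have g0 : g 0 = 0 := g0
  have hg1 : ∀ m n, g m + g n - g (m + n) = S.1 (E.proj m) (E.proj n) := fun m n =>
    congrFun (congrFun (congrArg Prod.fst hg) m) n
  have hg2 : ∀ r m, r • g m - g (r • m) = S.2.1 r (E.proj m) := fun r m =>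
    congrFun (congrFun (congrArg (fun c => c.2.1) hg) r) m
  have hg3 : ∀ f m, (∑ i, (D.actM E).act f i m (g (m i))) - g (mop R ar f m) =
      S.2.2 f (fun j => E.proj (m j)) := fun f m =>
    congrFun (congrFun (congrArg (fun c => c.2.2) hg) f) m
  -- `S` is normalized, so `g` is compatible with the operations whenever an argument is in `I`.
  have k1 : ∀ m b, g (m + E.incl b) = g m + g (E.incl b) := fun m b => by
    rw [eq_comm, ← sub_eq_zero, hg1, E.proj_incl, (s1 _).1]
  have k2 : ∀ r b, g (r • E.incl b) = r • g (E.incl b) := fun r b => by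
    rw [eq_comm, ← sub_eq_zero, hg2, E.proj_incl, s2]
  have k3 : ∀ f m i, E.proj (m i) = 0 →
      g (mop R ar f m) = ∑ i, (D.actM E).act f i m (g (m i)) := fun f m i hi => by
    rw [eq_comm, ← sub_eq_zero, hg3, s3 f _ ⟨i, hi⟩]
  let d : Der (D.actI E) := ⟨fun b => -g (E.incl b), mem_Der_iff.mpr
    ⟨fun b c => by rw [map_add, k1]; abel, fun r b => by rw [map_smul, k2, smul_neg],
      fun f b => by
        rw [E.incl_op, k3 f _ ⟨0, har f⟩ (E.proj_incl _)]
        simp only [map_neg, Finset.sum_neg_distrib]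
        rfl⟩⟩
  have hd : ∀ b, d.1 b = -g (E.incl b) := fun _ => rfl
  refine ⟨d, ⟨fun x => -g (L.l x), fun f s hs _ x b => ?_⟩, fun x => g (L.l x), ?_, ?_⟩
  · obtain ⟨j, hj⟩ := id hs
    rw [hd, E.incl_bAct, k3 f _ j (by rw [Extension.mix, if_pos hj, E.proj_incl]),
      ← Finset.sum_add_sum_compl s, neg_add_rev, ← Finset.sum_neg_distrib,
      ← Finset.sum_neg_distrib]
    congr 1
    · refine Finset.sum_congr rfl fun i hi => ?_
      rw [show E.mix L s x b i = L.l (x i) from if_neg (Finset.mem_compl.mp hi), map_neg]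
    · refine Finset.sum_congr rfl fun i hi => ?_
      rw [show E.mix L s x b i = E.incl (b i) from if_pos hi, hd, map_neg]
  · change g (L.l 0) = 0
    rw [L.l_zero, g0]
  · refine Prod.ext ?_ (Prod.ext ?_ ?_)
    · funext x y
      change g (L.l x) + g (L.l y) - g (L.l (x + y)) = S.1 x y - -g (E.incl _)
      have e := hg1 (L.l x) (L.l y)
      rw [L.proj_l, L.proj_l, show L.l x + L.l y = L.l (x + y) + E.incl ((E.factorSets L).1 x y) by
        rw [E.incl_factorSets_add]; abel, k1] at e
      rw [← e]; abel
    · funext r x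
      change r • g (L.l x) - g (L.l (r • x)) = S.2.1 r x - -g (E.incl _)
      have e := hg2 r (L.l x)
      rw [L.proj_l, show r • L.l x = L.l (r • x) + E.incl ((E.factorSets L).2.1 r x) by
        rw [E.incl_factorSets_smul]; abel, k1] at e
      rw [← e]; abel
    · funext f x
      change (∑ i, (D.actM E).act f i (fun j => L.l (x j)) (g (L.l (x i)))) -
        g (L.l (mop R ar f x)) = S.2.2 f x - -g (E.incl _)
      have e := hg3 f (fun j => L.l (x j))
      simp only [L.proj_l] at e
      rw [show mop R ar f (fun j => L.l (x j)) =
        L.l (mop R ar f x) + E.incl ((E.factorSets L).2.2 f x) by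
        rw [E.incl_factorSets_op]; abel, k1] at e
      rw [← e]; abel

end

end MultExp

theorem theorem5p1 {R : Type*} [Ring R] {F : Type*} (ar : F → ℕ) (har : ∀ f, 1 ≤ ar f)
    (V : Variety R ar) {I M Q A : Type*}
    [AddCommGroup I] [Module R I] [MultiOps R ar I]
    [AddCommGroup M] [Module R M] [MultiOps R ar M]
    [AddCommGroup Q] [Module R Q] [MultiOps R ar Q]
    [AddCommGroup A] [Module R A] [MultiOps R ar A]
    (hM : V.Mem M) (E : Extension R ar I M Q) (D : AffineDatum V M A) (L : E.Lifting) :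
    -- `A^I` is a subalgebra of `A`, and the induced action of `Q` on it is `𝒱`-compatible
    (∀ (f : F) (a : Fin (ar f) → A), (∀ j, a j ∈ D.nullI E) → mop R ar f a ∈ D.nullI E) ∧
    (∀ (f : F) (i : Fin (ar f)) (m : Fin (ar f) → M) (a : D.nullI E),
      (D.actQ E L).act f i (fun j => E.proj (m j)) a = (D.actM E).act f i m a) ∧
    IsCompatible V (D.actQ E L) ∧
    ∃ (σ₁ : H1 (D.actQ E L) →+ H1 (D.actM E))
      (r : H1 (D.actM E) →+ D.H1Square E L)
      (δ : D.H1Square E L →+ H2 V (D.actQ E L))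
      (σ₂ : H2 V (D.actQ E L) →+ H2 V (D.actM E)),
      -- inflation of derivations, restriction, transgression, inflation of 2-cocycles
      (∀ d : Der (D.actQ E L), ∃ hd : d.1 ∘ E.proj ∈ Der (D.actM E),
        σ₁ (H1.mk d) = H1.mk ⟨d.1 ∘ E.proj, hd⟩) ∧
      (∀ d : Der (D.actM E), ∃ hd : d.1 ∘ E.incl ∈ Der (D.actI E),
        (r (H1.mk d) : H1 (D.actI E)) = H1.mk ⟨d.1 ∘ E.incl, hd⟩) ∧
      (∀ (d : Der (D.actI E)) (c : D.H1Square E L), (c : H1 (D.actI E)) = H1.mk d →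
        ∃ hT : Cochain.post d.1 (E.factorSets L) ∈ Z2 V (D.actQ E L),
          δ c = H2.mk ⟨Cochain.post d.1 (E.factorSets L), hT⟩) ∧
      (∀ T : Z2 V (D.actQ E L), ∃ hT : Cochain.pre T.1 E.proj ∈ Z2 V (D.actM E),
        σ₂ (H2.mk T) = H2.mk ⟨Cochain.pre T.1 E.proj, hT⟩) ∧
      -- exactness
      Function.Injective σ₁ ∧ Function.Exact σ₁ r ∧ Function.Exact r δ ∧ Function.Exact δ σ₂ := by
  have hproj := D.isActionHom_proj E L
  have hincl := D.isActionHom_incl E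
  have hsurj := E.surjective
  let r : H1 (D.actM E) →+ D.H1Square E L := hincl.mapH1.codRestrict _ fun c => by
    induction c using QuotientAddGroup.induction_on with
    | H d => exact ⟨_, AffineDatum.comp_incl_mem_squareDer d, rfl⟩
  let δ : D.H1Square E L →+ H2 V (D.actQ E L) :=
    (D.transgression E L hM).comp (D.squareEquiv E L).symm.toAddMonoidHom
  have hδ : ∀ d : D.squareDer E L, δ (D.squareEquiv E L d) = D.transgression E L hM d := fun d =>
    congrArg (D.transgression E L hM) ((D.squareEquiv E L).symm_apply_apply d)
  have hr : ∀ d : Der (D.actM E), r (H1.mk d) =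
      D.squareEquiv E L ⟨_, AffineDatum.comp_incl_mem_squareDer d⟩ := fun d => Subtype.ext rfl
  refine ⟨D.mop_mem_nullI E har, fun f i m a => congrArg (fun g => g a) (hproj.act_comp f i m),
    hproj.isCompatible hsurj (D.compatible.onNull _), hproj.mapH1, r, δ, hproj.mapH2 V,
    fun d => ⟨_, hproj.mapH1_mk d⟩, fun d => ⟨_, rfl⟩, fun d c hc => ?_,
    fun T => ⟨_, hproj.mapH2_mk T⟩, hproj.mapH1_injective hsurj, fun c => ⟨?_, ?_⟩,
    fun c => ⟨?_, ?_⟩, fun c => ⟨?_, ?_⟩⟩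
  · obtain ⟨d', rfl⟩ := (D.squareEquiv E L).surjective c
    obtain rfl : d'.1 = d := D.mkI_injective E hc
    exact ⟨_, hδ d'⟩
  · induction c using QuotientAddGroup.induction_on with
    | H d =>
      intro hc
      have h0 : H1.mk ⟨d.1 ∘ E.incl, hincl.comp_mem_Der d.2⟩ = H1.mk (α := D.actI E) 0 :=
        congrArg Subtype.val hc
      have h1 := congrArg Subtype.val (D.mkI_injective E h0)
      obtain ⟨d', hd'⟩ := AffineDatum.exists_comp_proj_eq (L := L) d (congrFun h1)
      exact ⟨H1.mk d', (hproj.mapH1_mk d').trans (congrArg H1.mk (Subtype.ext hd'))⟩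
  · rintro ⟨c, rfl⟩
    induction c using QuotientAddGroup.induction_on with
    | H d =>
      refine Subtype.ext (congrArg H1.mk (Subtype.ext (funext fun b => ?_)))
      change d.1 (E.proj (E.incl b)) = 0
      rw [E.proj_incl, Der.map_zero]
  · intro hc
    obtain ⟨d, rfl⟩ := (D.squareEquiv E L).surjective c
    rw [hδ] at hc
    obtain ⟨d', hd'⟩ := AffineDatum.exists_comp_incl_eq d.2 ((H2.mk_eq_zero_iff _).mp hc)
    exact ⟨H1.mk d', (hr d').trans (congrArg _ (Subtype.ext (Subtype.ext hd')))⟩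
  · rintro ⟨c, rfl⟩
    induction c using QuotientAddGroup.induction_on with
    | H d =>
      refine (congrArg δ (hr d)).trans ((hδ _).trans ((H2.mk_eq_zero_iff _).mpr ?_))
      refine ⟨fun x => d.1 (L.l x), ?_, (AffineDatum.post_comp_incl d).symm⟩
      change d.1 (L.l 0) = 0
      rw [L.l_zero, Der.map_zero]
  · induction c using QuotientAddGroup.induction_on with
    | H S =>
      intro hc
      obtain ⟨d, hd, hS⟩ :=
        AffineDatum.exists_sub_post_mem_B2 har S.2 ((H2.mk_eq_zero_iff _).mp hc)
      refine ⟨D.squareEquiv E L ⟨d, hd⟩, (hδ _).trans (QuotientAddGroup.eq.mpr ?_)⟩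
      rw [neg_add_eq_sub]
      exact hS
  · rintro ⟨c, rfl⟩
    obtain ⟨d, rfl⟩ := (D.squareEquiv E L).surjective c
    rw [hδ]
    refine (H2.mk_eq_zero_iff _).mpr
      ⟨fun m => -d.1.1 (E.ret L m), ?_, (AffineDatum.pre_post_eq d.2).symm⟩
    change -d.1.1 (E.ret L 0) = 0
    rw [← L.l_zero, E.ret_lift, Der.map_zero, neg_zero]
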